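/- Let $d\ge 3$ be odd and $k \geq 1$. Order the cells of $[k]^d$ lexicographically. A set $T\subseteq[k]^d$ is a magic set if all its slices $\{x\in T: x_\ell=i\}$ ($\ell\in[d]$, $i\in[k]$) have the same size. For a finite integer sequence $a$ let $\mathrm{msgn}(a)=(-1)^{\mathrm{inv}(a)}$, where $\mathrm{inv}(a)$ is the number of inversions of $a$. For a magic set $T$ let $\mathrm{sgn}(T)=\prod_{\ell=1}^d \mathrm{msgn}(T_\ell)$, where $T_\ell$ is the sequence of the $\ell$-th coordinates of the cells of $T$ in lexicographic order. For a magic set $T$ of cardinality $nk$, a partial Latin hypercube of type $T$ is a function $C:[k]^d\to\{0,1,\dots,n\}$ with $T=\{x: C(x)\neq 0\}$ such that in every slice of $[k]^d$ the nonzero values of $C$, listed in lexicographic order of the cells, form a permutation of $[n]$; its sign $\mathrm{sgn}(C)$ is the product of the signs of these permutations over all $dk$ slices. Let $AT_d(k,T)=\sum_C \mathrm{sgn}(C)$, the sum over all partial Latin hypercubes $C$ of type $T$, and $AT_d(k)=AT_d(k,[k]^d)$. Let $e_1,\dots,e_k$ be the standard basis of $\mathbb C^k$. For $P\subseteq[k]^d$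 let $\psi_P\in\bigwedge^{|P|}(\mathbb C^k)^{\otimes d}$ be the wedge product of the vectors $e_{x_1}\otimes\cdots\otimes e_{x_d}$, $x\in P$, in lexicographic order, and let $\mathcal B_{d,k}(n)=\mathrm{span}\{\psi_P : P\subseteq [k]^d \text{ a magic set},\ |P|=nk\}$. Put $$\omega=\sum_{\pi_2,\dots,\pi_d\in S_k}\mathrm{sgn}(\pi_2\cdots\pi_d)\bigwedge_{i=1}^k e_i\otimes e_{\pi_2(i)}\otimes\cdots\otimes e_{\pi_d(i)}\in\textstyle\bigwedge^k(\mathbb C^k)^{\otimes d},$$ and let powers of $\omega$ be taken in the exterior algebra. The group $\mathrm{GL}(k)^{\times d}$ acts componentwise. A highest weight vector is a nonzero vector $v$ that is a weight vector for the $d$-tuples of invertible diagonal matrices and is annihilated by all raising operators, that is, by the Lie algebra elements having the matrix unit $E_{i,j}$ with $i<j$ in one of the $d$ components and $0$ in the others. The weight is $(k\times 1)^d$ if the tuple $(\mathrm{diag}(a^{(\ell)}_1,\dots,a^{(\ell)}_k))_{\ell=1}^d$ multiplies $v$ by $\prod_{\ell=1}^d\prod_{i=1}^k a^{(\ell)}_i$.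 Then: (i) $\omega$ is, up to a nonzero scalar, the unique highest weight vector in $\mathcal B_{d,k}(1)$; equivalently, it is, up to a nonzero scalar, the unique highest weight vector of weight $(k\times 1)^d$ in $\bigwedge^k(\mathbb C^k)^{\otimes d}$. (ii) If $k$ is even, then for every $0\le n\le k^{d-1}$ there is a sign, the same for all $T$, such that $$\omega^n=\pm\sum_T \mathrm{sgn}(T)\,AT_d(k,T)\,\psi_T,$$ where $T$ runs over all magic sets $T\subseteq[k]^d$ of cardinality $nk$. In particular $\omega^{k^{d-1}}=\pm AT_d(k)\,\psi_{[k]^d}$. (iii) If $k$ is odd, then $\omega^2=0$. -/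

import Mathlib

noncomputable section

namespace HyperForm

/-! ### Cells, magic sets, partial Latin hypercubes and their signs -/

/-- The box `[k]^d` of cells (with `[k]` modelled by `Fin k`), ordered lexicographically. -/
abbrev Cell (d k : ℕ) : Type := Lex (Fin d → Fin k)

/-- The `ℓ`-th coordinate of a cell. -/
def coord {d k : ℕ} (ℓ : Fin d) (x : Cell d k) : Fin k := ofLex x ℓ

/-- The elements of `T` in the `i`-th slice in direction `ℓ`. -/
def sliceOf {d k : ℕ} (T : Finset (Cell d k)) (ℓ : Fin d) (i : Fin k) : Finset (Cell d k) :=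
  T.filter fun x => coord ℓ x = i

/-- A magic set has the same number of elements in every slice (of every direction). -/
def IsMagic {d k : ℕ} (T : Finset (Cell d k)) : Prop :=
  ∀ (ℓ ℓ' : Fin d) (i i' : Fin k), (sliceOf T ℓ i).card = (sliceOf T ℓ' i').card

open Classical in
/-- The magic sets of cardinality `n * k`. -/
def magicSets (d k n : ℕ) : Finset (Finset (Cell d k)) :=
  Finset.univ.filter fun T => IsMagic T ∧ T.card = n * k

open Classical in
/-- The number of inversions of the sequence obtained by listing the values `f x`, `x ∈ S`, in the
lexicographic order of the cells `x`. -/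
def inv {d k : ℕ} {α : Type*} [LinearOrder α] (S : Finset (Cell d k)) (f : Cell d k → α) : ℕ :=
  ((S ×ˢ S).filter fun p => p.1 < p.2 ∧ f p.2 < f p.1).card

/-- The sign `(-1)^inv` of the sequence of the values `f x`, `x ∈ S`, listed in the lexicographic
order of the cells `x`; it is the usual sign if that sequence is a permutation. -/
def msgn {d k : ℕ} {α : Type*} [LinearOrder α] (S : Finset (Cell d k)) (f : Cell d k → α) : ℤ :=
  (-1) ^ inv S f

/-- The sign of a set of cells: the product over the directions `ℓ` of the signs of the sequences
of `ℓ`-th coordinates of its cells, listed lexicographically. -/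
def setSign {d k : ℕ} (T : Finset (Cell d k)) : ℤ :=
  ∏ ℓ : Fin d, msgn T (coord ℓ)

/-- `C : [k]^d → {0, …, n}` is a partial Latin hypercube of length `k`, type `T` and cardinality
`n * k`: its nonzero cells form the magic set `T` of cardinality `n * k`, and the nonzero values in
every slice are a rearrangement of `1, …, n`. -/
def IsPartialLatin {d k n : ℕ} (T : Finset (Cell d k)) (C : Cell d k → Fin (n + 1)) : Prop :=
  T ∈ magicSets d k n ∧ (∀ x, x ∈ T ↔ C x ≠ 0) ∧
    ∀ (ℓ : Fin d) (i : Fin k), Set.BijOn C (sliceOf T ℓ i : Set (Cell d k)) {c | c ≠ 0}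

/-- The directional sign: the product of the signs of the permutations formed by the nonzero values
of `C` in the slices in direction `ℓ`, listed lexicographically. -/
def dirSign {d k n : ℕ} (C : Cell d k → Fin (n + 1)) (ℓ : Fin d) : ℤ :=
  ∏ i : Fin k, msgn (sliceOf (Finset.univ.filter fun x => C x ≠ 0) ℓ i) C

/-- The full sign: the product of all directional signs. -/
def fullSign {d k n : ℕ} (C : Cell d k → Fin (n + 1)) : ℤ :=
  ∏ ℓ : Fin d, dirSign C ℓ

open Classical in
/-- The Alon--Tarsi number `AT_d(k, T)`, where `T` is a magic set of cardinality `n * k`: the sum of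
the full signs of all partial Latin hypercubes of length `k` and type `T`. -/
def AT (d k n : ℕ) (T : Finset (Cell d k)) : ℤ :=
  ∑ C ∈ (Finset.univ : Finset (Cell d k → Fin (n + 1))).filter (IsPartialLatin T), fullSign C

/-- The Alon--Tarsi number `AT_d(k)` of the full box `[k]^d`, of cardinality `k^(d-1) * k`. -/
def ATfull (d k : ℕ) : ℤ := AT d k (k ^ (d - 1)) Finset.univ

/-! ### The exterior algebra of `(ℂ^k)^{⊗ d}` -/

/-- The tensor space `(ℂ^k)^{⊗ d}`. -/
abbrev TensorSpace (d k : ℕ) : Type := PiTensorProduct ℂ fun _ : Fin d => (Fin k → ℂ)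

/-- The exterior algebra of `(ℂ^k)^{⊗ d}`; its part of degree `m` is the submodule
`⋀[ℂ]^m (TensorSpace d k)`. -/
abbrev Forms (d k : ℕ) : Type := ExteriorAlgebra ℂ (TensorSpace d k)

/-- The standard basis tensor `e_{x 1} ⊗ ⋯ ⊗ e_{x d}` of a cell. -/
def basisTensor {d k : ℕ} (x : Cell d k) : TensorSpace d k :=
  PiTensorProduct.tprod ℂ fun ℓ => (Pi.single (coord ℓ x) 1 : Fin k → ℂ)

/-- `ψ_P`: the wedge product of the basis tensors of the cells of `P` in lexicographic order. -/
def psi {d k : ℕ} (P : Finset (Cell d k)) : Forms d k :=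
  ExteriorAlgebra.ιMulti ℂ P.card fun i => basisTensor (P.orderEmbOfFin rfl i)

/-- `B_{d,k}(n)`: the span of the `ψ_P`, `P` a magic set of cardinality `n * k`. -/
def weightB (d k n : ℕ) : Submodule ℂ (Forms d k) :=
  Submodule.span ℂ (psi '' (magicSets d k n : Set (Finset (Cell d k))))

/-- The hyperdeterminantal form
`ω = ∑ sgn(π_2 ⋯ π_d) ⋀_i e_i ⊗ e_{π_2 i} ⊗ ⋯ ⊗ e_{π_d i}`, the sum being over all
tuples of permutations whose first entry is the identity. -/
def omega (d k : ℕ) : Forms d k :=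
  ∑ π ∈ (Finset.univ : Finset (Fin d → Equiv.Perm (Fin k))).filter
      (fun π => ∀ ℓ : Fin d, (ℓ : ℕ) = 0 → π ℓ = 1),
    ((∏ ℓ, (Equiv.Perm.sign (π ℓ) : ℤ) : ℤ) : ℂ) •
      ExteriorAlgebra.ιMulti ℂ k fun i => basisTensor (toLex fun ℓ => π ℓ i)

/-! ### Weights, raising operators and highest weight vectors -/

/-- The componentwise action of a tuple of matrices (for invertible ones: of an element of
`GL(k)^{× d}`) on the exterior algebra of `(ℂ^k)^{⊗ d}`. -/
def act {d k : ℕ} (g : Fin d → Matrix (Fin k) (Fin k) ℂ) : Forms d k →ₐ[ℂ] Forms d k :=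
  ExteriorAlgebra.map (PiTensorProduct.map fun ℓ => Matrix.toLin' (g ℓ))

/-- `v` is rescaled by the tuples of invertible diagonal matrices according to the weight `wt`. -/
def HasWeight {d k : ℕ} (wt : Fin d → Fin k → ℤ) (v : Forms d k) : Prop :=
  ∀ a : Fin d → Fin k → ℂˣ,
    act (fun ℓ => Matrix.diagonal fun i => (a ℓ i : ℂ)) v =
      (∏ ℓ, ∏ i, (a ℓ i : ℂ) ^ wt ℓ i) • v

section Derivation

variable {V : Type*} [AddCommGroup V] [Module ℂ V]

/-- The algebra map `⋀V → ⋀V[ε]/ε²` (dual numbers) extending `x ↦ x + ε A x`, i.e. the action of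
`1 + ε A` to first order in `ε`. -/
def dualAct (A : V →ₗ[ℂ] V) :
    ExteriorAlgebra ℂ V →ₐ[ℂ] TrivSqZeroExt (ExteriorAlgebra ℂ V) (ExteriorAlgebra ℂ V) :=
  ExteriorAlgebra.lift ℂ
    ⟨(TrivSqZeroExt.inlAlgHom ℂ (ExteriorAlgebra ℂ V) (ExteriorAlgebra ℂ V)).toLinearMap ∘ₗ
        ExteriorAlgebra.ι ℂ +
      (TrivSqZeroExt.inrHom (ExteriorAlgebra ℂ V) (ExteriorAlgebra ℂ V)).restrictScalars ℂ ∘ₗ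
        ExteriorAlgebra.ι ℂ ∘ₗ A, fun x => by
      ext
      · simp
      · simp [ExteriorAlgebra.ι_add_mul_swap]⟩

/-- The infinitesimal action of the endomorphism `A` of `V` on the exterior algebra: the coefficient
of `ε` in the action of `1 + ε A`. By the lemmas below it is the derivation of the exterior algebra
extending `A`, so `v_1 ∧ ⋯ ∧ v_m` goes to `∑ j, v_1 ∧ ⋯ ∧ A v_j ∧ ⋯ ∧ v_m`. -/
def lieAct (A : V →ₗ[ℂ] V) : ExteriorAlgebra ℂ V →ₗ[ℂ] ExteriorAlgebra ℂ V :=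
  (TrivSqZeroExt.sndHom (ExteriorAlgebra ℂ V) (ExteriorAlgebra ℂ V)).restrictScalars ℂ ∘ₗ
    (dualAct A).toLinearMap

theorem dualAct_fst (A : V →ₗ[ℂ] V) (x : ExteriorAlgebra ℂ V) : (dualAct A x).fst = x := by
  have h : (TrivSqZeroExt.fstHom ℂ (ExteriorAlgebra ℂ V) (ExteriorAlgebra ℂ V)).comp (dualAct A) =
      AlgHom.id ℂ _ := by
    ext v
    simp [dualAct]
  exact DFunLike.congr_fun h x

theorem lieAct_ι (A : V →ₗ[ℂ] V) (v : V) :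
    lieAct A (ExteriorAlgebra.ι ℂ v) = ExteriorAlgebra.ι ℂ (A v) := by
  simp [lieAct, dualAct]

theorem lieAct_one (A : V →ₗ[ℂ] V) : lieAct A (1 : ExteriorAlgebra ℂ V) = 0 := by
  simp [lieAct]

theorem lieAct_mul (A : V →ₗ[ℂ] V) (x y : ExteriorAlgebra ℂ V) :
    lieAct A (x * y) = lieAct A x * y + x * lieAct A y := by
  simp [lieAct, dualAct_fst, add_comm]

end Derivation

/-- The operator by which the matrix unit `E_{i,j}`, placed in the direction `ℓ`, acts; for `i < j`
it is a raising operator. -/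
def raising {d k : ℕ} (ℓ : Fin d) (i j : Fin k) : Forms d k →ₗ[ℂ] Forms d k :=
  lieAct (PiTensorProduct.map
    (Function.update (fun _ : Fin d => (LinearMap.id : (Fin k → ℂ) →ₗ[ℂ] (Fin k → ℂ))) ℓ
      (Matrix.toLin' (Matrix.single i j (1 : ℂ)))))

/-- A highest weight vector: a nonzero weight vector annihilated by all raising operators. -/
def IsHighestWeightVector {d k : ℕ} (v : Forms d k) : Prop :=
  v ≠ 0 ∧ (∃ wt, HasWeight wt v) ∧ ∀ (ℓ : Fin d) (i j : Fin k), i < j → raising ℓ i j v = 0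

end HyperForm

end

/-! Everything is computed in the monomial basis `psi` of the exterior algebra. The magic sets of
size k are the diagonals; indexing the cells of a diagonal by coordinate 0 describes it by a unique
tuple of permutations with `π 0 = 1`, so ω is the sum of sgn(P) ψ_P over all diagonals P. Reindexing
a diagonal by σ costs sgn(σ) in the wedge and sgn(σ)^d in the coefficient. These cancel for odd d,
so k!·ω is the signed sum over all of S_k^d (`factorial_smul_omega`).

Part (i). E_{i,j} in one direction merges the labels i and j, so it does not see a prior swap of
them, while the swap flips the coefficient; hence raising operators kill ω. Conversely, on B(1) the
composite E_{j,i} E_{i,j} is the identity plus the swap (`lowering_raising_diagForm`). A vector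
killed by raising operators therefore transforms by the sign under S_k^d (`permAct_eq_smul`), and
antisymmetrization sends B(1) into the line of ω. Since ψ_P has its slice sizes as weight, weight
(k×1)^d already forces membership in B(1).

Part (ii). Expanding ω^n gives ordered n-tuples of diagonals. Overlapping tuples vanish; disjoint
ones are the colour classes of partial Latin hypercubes. Sorting the wedge costs the sign of the
colour sequence, which a count of inversions in each direction (`msgn_mul_fiber_eq`) relates to
sgn(T) and sgn(C), up to a sign `gridSign` depending only on k and n. For odd d the product over
directions keeps one copy of the colour sign and of `gridSign`.

Part (iii). Forms of odd degree anticommute. -/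

noncomputable section

namespace HyperForm

open Finset

/-! ### The monomial basis of the exterior algebra -/

/-- The basis of `(ℂ^k)^{⊗ d}` formed by the basis tensors of the cells. -/
def cellBasis (d k : ℕ) : Module.Basis (Cell d k) ℂ (TensorSpace d k) :=
  (Basis.piTensorProduct fun _ : Fin d => Pi.basisFun ℂ (Fin k)).reindex toLex

theorem cellBasis_apply {d k : ℕ} (x : Cell d k) : cellBasis d k x = basisTensor x := by
  simp only [cellBasis, Module.Basis.reindex_apply, Basis.piTensorProduct_apply, basisTensor]
  congr 1
  ext ℓ
  simp [coord]

/-- The basis of the exterior algebra formed by the `ψ_P`. -/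
def formBasis (d k : ℕ) : Module.Basis (Finset (Cell d k)) ℂ (Forms d k) :=
  (cellBasis d k).ExteriorAlgebra

theorem psi_eq_of_card {d k m : ℕ} {P : Finset (Cell d k)} (h : P.card = m) :
    psi P = ExteriorAlgebra.ιMulti ℂ m fun i => basisTensor (P.orderEmbOfFin h i) := by
  subst h
  rfl

theorem formBasis_apply {d k : ℕ} (P : Finset (Cell d k)) : formBasis d k P = psi P := by
  rw [formBasis, ExteriorAlgebra.basis_apply, psi]
  exact congrArg (ExteriorAlgebra.ιMulti ℂ P.card) (funext fun i => cellBasis_apply _)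

theorem psi_eq_ιMulti {d k m : ℕ} {P : Finset (Cell d k)} (f : Fin m → Cell d k)
    (hf : StrictMono f) (hP : univ.image f = P) :
    psi P = ExteriorAlgebra.ιMulti ℂ m fun i => basisTensor (f i) := by
  have h : P.card = m := by
    rw [← hP, card_image_of_injective _ hf.injective, card_fin]
  rw [psi_eq_of_card h, ← orderEmbOfFin_unique h (f := f) (fun i => by simp [← hP]) hf]

theorem psi_empty {d k : ℕ} : psi (∅ : Finset (Cell d k)) = 1 := by
  rw [psi_eq_ιMulti (m := 0) (fun i => i.elim0) (fun i => i.elim0) (by simp)]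
  simp

theorem psi_mul_of_not_disjoint {d k : ℕ} {P Q : Finset (Cell d k)} (h : ¬Disjoint P Q) :
    psi P * psi Q = 0 := by
  rw [← formBasis_apply, ← formBasis_apply]
  exact ExteriorAlgebra.basis_mul_of_not_disjoint (cellBasis d k)
    (Set.powersetCard.ofCard (rfl : P.card = _)) (Set.powersetCard.ofCard (rfl : Q.card = _)) h

/-- The basis of every later sign computation: products of monomials are evaluated by peeling off
the least cell. -/
theorem psi_insert_min {d k : ℕ} {P : Finset (Cell d k)} {a : Cell d k} (h : ∀ x ∈ P, a < x) :
    psi (insert a P) = ExteriorAlgebra.ι ℂ (basisTensor a) * psi P := by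
  rw [psi_eq_ιMulti (m := P.card + 1) (Fin.cons a (P.orderEmbOfFin rfl)),
    ExteriorAlgebra.ιMulti_succ_apply]
  · rfl
  · intro i j hij
    induction j using Fin.cases with
    | zero => exact absurd hij (Fin.not_lt_zero i)
    | succ j =>
      induction i using Fin.cases with
      | zero => exact h _ (orderEmbOfFin_mem _ _ _)
      | succ i => exact (P.orderEmbOfFin rfl).strictMono (Fin.succ_lt_succ_iff.1 hij)
  · rw [← coe_inj, coe_image, coe_univ, Set.image_univ, Fin.range_cons, range_orderEmbOfFin,
      coe_insert]

/-! ### Characterisation of magic sets -/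

theorem sum_card_sliceOf {d k : ℕ} (T : Finset (Cell d k)) (ℓ : Fin d) :
    ∑ i, (sliceOf T ℓ i).card = T.card :=
  (card_eq_sum_card_fiberwise (f := coord ℓ) (t := univ) fun _ _ => by simp).symm

theorem mem_magicSets {d k n : ℕ} [NeZero d] {T : Finset (Cell d k)} :
    T ∈ magicSets d k n ↔ ∀ ℓ i, (sliceOf T ℓ i).card = n := by
  simp only [magicSets, mem_filter, mem_univ, true_and]
  constructor
  · rintro ⟨hm, hc⟩ ℓ i
    have h := sum_card_sliceOf T ℓ
    rw [sum_congr rfl fun j _ => hm ℓ ℓ j i, sum_const, hc, card_univ, Fintype.card_fin,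
      smul_eq_mul, mul_comm] at h
    exact Nat.eq_of_mul_eq_mul_right i.pos h
  · intro h
    refine ⟨fun ℓ ℓ' i i' => by rw [h, h], ?_⟩
    rw [← sum_card_sliceOf T 0]
    simp [h, mul_comm]

/-! ### Diagonals -/

/-- The `i`-th cell of the diagonal described by a tuple of permutations. -/
def diagCell {d k : ℕ} (π : Fin d → Equiv.Perm (Fin k)) (i : Fin k) : Cell d k :=
  toLex fun ℓ => π ℓ i

@[simp]
theorem coord_diagCell {d k : ℕ} (π : Fin d → Equiv.Perm (Fin k)) (i : Fin k) (ℓ : Fin d) :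
    coord ℓ (diagCell π i) = π ℓ i := rfl

theorem cell_ext {d k : ℕ} {x y : Cell d k} (h : ∀ ℓ, coord ℓ x = coord ℓ y) : x = y :=
  ofLex.injective (funext h)

/-- The set of cells of the diagonal described by a tuple of permutations. -/
def diagSet {d k : ℕ} (π : Fin d → Equiv.Perm (Fin k)) : Finset (Cell d k) :=
  univ.image (diagCell π)

/-- The wedge product of the basis tensors of the cells of a diagonal. -/
def diagForm {d k : ℕ} (π : Fin d → Equiv.Perm (Fin k)) : Forms d k :=
  ExteriorAlgebra.ιMulti ℂ k fun i => basisTensor (diagCell π i)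

/-- The product of the signs of a tuple of permutations. -/
def tupleSign {d k : ℕ} (π : Fin d → Equiv.Perm (Fin k)) : ℤ :=
  ∏ ℓ, (Equiv.Perm.sign (π ℓ) : ℤ)

theorem tupleSign_mul {d k : ℕ} (π ρ : Fin d → Equiv.Perm (Fin k)) :
    tupleSign (π * ρ) = tupleSign π * tupleSign ρ := by
  simp [tupleSign, prod_mul_distrib]

theorem tupleSign_mul_self {d k : ℕ} (π : Fin d → Equiv.Perm (Fin k)) :
    tupleSign π * tupleSign π = 1 := by
  rw [tupleSign, ← prod_mul_distrib]
  refine prod_eq_one fun ℓ _ => ?_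
  rw [← Units.val_mul, Int.units_mul_self, Units.val_one]

section Normalized

variable {d k : ℕ} [NeZero d]

theorem diagCell_strictMono {π : Fin d → Equiv.Perm (Fin k)} (h : π 0 = 1) :
    StrictMono (diagCell π) := by
  intro i j hij
  exact ⟨0, fun l hl => absurd hl (Fin.not_lt_zero l), by simpa [diagCell, h] using hij⟩

theorem psi_diagSet {π : Fin d → Equiv.Perm (Fin k)} (h : π 0 = 1) :
    psi (diagSet π) = diagForm π :=
  psi_eq_ιMulti _ (diagCell_strictMono h) rfl

theorem diagCell_injective (π : Fin d → Equiv.Perm (Fin k)) :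
    Function.Injective (diagCell π) := fun _ _ h =>
  (π 0).injective (congrArg (coord 0) h)

theorem diagSet_mem_magicSets (π : Fin d → Equiv.Perm (Fin k)) :
    diagSet π ∈ magicSets d k 1 := by
  rw [mem_magicSets]
  intro ℓ i
  rw [card_eq_one]
  refine ⟨diagCell π ((π ℓ).symm i), ?_⟩
  ext x
  simp only [sliceOf, diagSet, mem_filter, mem_image, mem_univ, true_and, mem_singleton]
  constructor
  · rintro ⟨⟨j, rfl⟩, hj⟩
    rw [← hj]
    simp
  · rintro rfl
    simp

/-- With `π 0 = 1` the lexicographic order of the diagonal is the order of the index i, so the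
sequence of ℓ-th coordinates is `π ℓ` itself. -/
theorem msgn_diagSet {π : Fin d → Equiv.Perm (Fin k)} (h : π 0 = 1) (ℓ : Fin d) :
    msgn (diagSet π) (coord ℓ) = (Equiv.Perm.sign (π ℓ) : ℤ) := by
  have hinv : inv (diagSet π) (coord ℓ) =
      ((univ : Finset (Fin k × Fin k)).filter fun p => p.1 < p.2 ∧ π ℓ p.2 < π ℓ p.1).card := by
    symm
    refine card_bij (fun p _ => (diagCell π p.1, diagCell π p.2)) ?_ ?_ ?_
    · simp only [mem_filter, mem_univ, true_and, mem_product, diagSet, mem_image]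
      rintro p ⟨h1, h2⟩
      exact ⟨⟨⟨_, rfl⟩, ⟨_, rfl⟩⟩, diagCell_strictMono h h1, h2⟩
    · rintro p _ q _ hpq
      simp only [Prod.mk.injEq] at hpq
      exact Prod.ext (diagCell_injective π hpq.1) (diagCell_injective π hpq.2)
    · rintro ⟨x, y⟩ hxy
      simp only [mem_filter, mem_univ, true_and, mem_product, diagSet, mem_image] at hxy
      obtain ⟨⟨⟨i, rfl⟩, ⟨j, rfl⟩⟩, h1, h2⟩ := hxy
      exact ⟨(i, j), by simpa using ⟨(diagCell_strictMono h).lt_iff_lt.1 h1, h2⟩, rfl⟩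
  -- Both sides become products over pairs with a factor -1 for each inversion; pairs outside i < j
  -- contribute 1.
  rw [msgn, hinv, Equiv.Perm.sign_eq_prod_prod_Ioi, ← prod_const, prod_filter,
    ← univ_product_univ, prod_product, Units.coe_prod]
  refine prod_congr rfl fun i _ => ?_
  rw [Units.coe_prod, ← prod_subset (subset_univ (Ioi i))]
  · refine prod_congr rfl fun j hj => ?_
    have hij : i < j := mem_Ioi.1 hj
    rcases lt_trichotomy (π ℓ i) (π ℓ j) with h' | h' | h'
    · simp [h', h'.not_gt]
    · exact absurd ((π ℓ).injective h') hij.ne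
    · simp [h', h'.not_gt, hij]
  · intro j _ hj
    simp only [mem_Ioi] at hj
    simp [hj]

theorem setSign_diagSet {π : Fin d → Equiv.Perm (Fin k)} (h : π 0 = 1) :
    setSign (diagSet π) = tupleSign π :=
  prod_congr rfl fun ℓ _ => msgn_diagSet h ℓ

/-- Each slice contains one cell. Indexing the cells by coordinate 0 makes every other coordinate an
injective function of the index, hence a permutation. -/
theorem exists_diagSet_eq {P : Finset (Cell d k)} (hP : P ∈ magicSets d k 1) :
    ∃ π : Fin d → Equiv.Perm (Fin k), π 0 = 1 ∧ diagSet π = P := by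
  rw [mem_magicSets] at hP
  have hex : ∀ i, ∃ x ∈ P, coord 0 x = i := fun i => by
    obtain ⟨x, hx⟩ := card_eq_one.1 (hP 0 i)
    have : x ∈ sliceOf P 0 i := by simp [hx]
    exact ⟨x, (mem_filter.1 this).1, (mem_filter.1 this).2⟩
  have huniq : ∀ ℓ, ∀ x ∈ P, ∀ y ∈ P, coord ℓ x = coord ℓ y → x = y := fun ℓ x hx y hy h =>
    card_le_one.1 (hP ℓ (coord ℓ y)).le x (mem_filter.2 ⟨hx, h⟩) y (mem_filter.2 ⟨hy, rfl⟩)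
  choose x hxP hx0 using hex
  have hinj : ∀ ℓ, Function.Injective fun i => coord ℓ (x i) := fun ℓ i j h => by
    rw [← hx0 i, ← hx0 j, huniq ℓ _ (hxP i) _ (hxP j) h]
  refine ⟨fun ℓ => Equiv.ofBijective _ (Finite.injective_iff_bijective.1 (hinj ℓ)), ?_, ?_⟩
  · ext i
    simp [hx0]
  · ext y
    simp only [diagSet, mem_image, mem_univ, true_and]
    have hcell : ∀ i, diagCell (fun ℓ => Equiv.ofBijective _
        (Finite.injective_iff_bijective.1 (hinj ℓ))) i = x i := fun i => cell_ext fun ℓ => rfl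
    simp only [hcell]
    constructor
    · rintro ⟨i, rfl⟩
      exact hxP i
    · exact fun hy => ⟨coord 0 y, huniq 0 _ (hxP _) _ hy (hx0 _)⟩

theorem diagSet_injOn {π ρ : Fin d → Equiv.Perm (Fin k)} (hπ : π 0 = 1) (hρ : ρ 0 = 1)
    (h : diagSet π = diagSet ρ) : π = ρ := by
  funext ℓ
  ext1 i
  have : diagCell π i ∈ diagSet ρ := by
    rw [← h]
    exact mem_image_of_mem _ (mem_univ _)
  obtain ⟨j, -, hj⟩ := mem_image.1 this
  have h0 := congrArg (coord 0) hj
  simp only [coord_diagCell, hπ, hρ, Equiv.Perm.one_apply] at h0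
  subst h0
  exact (congrArg (coord ℓ) hj).symm

theorem omega_eq_sum_diagForm :
    omega d k = ∑ π ∈ univ.filter (fun π : Fin d → Equiv.Perm (Fin k) => π 0 = 1),
      (tupleSign π : ℂ) • diagForm π := by
  have hf : ∀ π : Fin d → Equiv.Perm (Fin k), (∀ ℓ : Fin d, (ℓ : ℕ) = 0 → π ℓ = 1) ↔ π 0 = 1 :=
    fun π => ⟨fun h => h 0 rfl, fun h ℓ hℓ => by
      rw [show ℓ = 0 from Fin.ext hℓ]
      exact h⟩
  simp only [omega, hf]
  rfl

/-- The form `ω` is the signed sum of the monomials of all diagonals. -/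
theorem omega_eq_sum_psi :
    omega d k = ∑ P ∈ magicSets d k 1, (setSign P : ℂ) • psi P := by
  rw [omega_eq_sum_diagForm]
  refine sum_bij (fun π _ => diagSet π) (fun π _ => diagSet_mem_magicSets π) ?_ ?_ ?_
  · intro π hπ ρ hρ h
    exact diagSet_injOn (mem_filter.1 hπ).2 (mem_filter.1 hρ).2 h
  · intro P hP
    obtain ⟨π, h0, h⟩ := exists_diagSet_eq hP
    exact ⟨π, by simpa using h0, h⟩
  · intro π hπ
    have h0 := (mem_filter.1 hπ).2
    rw [setSign_diagSet h0, psi_diagSet h0]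

theorem omega_mem_weightB : omega d k ∈ weightB d k 1 := by
  rw [omega_eq_sum_psi]
  exact Submodule.sum_mem _ fun P hP => Submodule.smul_mem _ _ (Submodule.subset_span ⟨P, hP, rfl⟩)

theorem omega_ne_zero : omega d k ≠ 0 := by
  intro h
  rw [omega_eq_sum_psi] at h
  simp only [← formBasis_apply] at h
  -- The main diagonal has coefficient 1.
  have h1 := linearIndependent_iff'.1 (formBasis d k).linearIndependent _ _ h (diagSet 1)
    (diagSet_mem_magicSets _)
  rw [setSign_diagSet rfl] at h1
  simp [tupleSign] at h1

/-- Elements of `B_{d,k}(1)` can be treated by linearity from the diagonals. -/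
theorem weightB_one_eq_span : weightB d k 1 =
    Submodule.span ℂ (diagForm '' {π : Fin d → Equiv.Perm (Fin k) | π 0 = 1}) := by
  rw [weightB]
  congr 1
  ext v
  constructor
  · rintro ⟨P, hP, rfl⟩
    obtain ⟨π, h0, rfl⟩ := exists_diagSet_eq (mem_coe.1 hP)
    exact ⟨π, h0, (psi_diagSet h0).symm⟩
  · rintro ⟨π, h0, rfl⟩
    exact ⟨diagSet π, diagSet_mem_magicSets π, psi_diagSet h0⟩

end Normalized

/-! ### Averaging over relabelings -/

/-- Right multiplication by a constant tuple only reorders the wedge factors. -/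
theorem diagForm_mul_const {d k : ℕ} (π : Fin d → Equiv.Perm (Fin k)) (σ : Equiv.Perm (Fin k)) :
    diagForm (π * fun _ => σ) = ((Equiv.Perm.sign σ : ℤ) : ℂ) • diagForm π := by
  have h := (ExteriorAlgebra.ιMulti ℂ k).map_perm (fun i => basisTensor (diagCell π i)) σ
  rw [Units.smul_def, ← Int.cast_smul_eq_zsmul ℂ] at h
  exact h

theorem tupleSign_const {d k : ℕ} (hd : Odd d) (σ : Equiv.Perm (Fin k)) :
    tupleSign (fun _ : Fin d => σ) = (Equiv.Perm.sign σ : ℤ) := by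
  rw [tupleSign, prod_const, card_univ, Fintype.card_fin, ← Units.val_pow_eq_pow_val,
    Int.units_pow_eq_pow_mod_two, Nat.odd_iff.1 hd, pow_one]

/-- For odd `d`, the form `ω` is up to the factor `k!` the signed sum over all tuples of
permutations. -/
theorem factorial_smul_omega {d k : ℕ} [NeZero d] (hd : Odd d) :
    (k.factorial : ℂ) • omega d k =
      ∑ π : Fin d → Equiv.Perm (Fin k), (tupleSign π : ℂ) • diagForm π := by
  rw [← sum_fiberwise (s := univ) (g := fun π : Fin d → Equiv.Perm (Fin k) => π 0)]
  -- Right multiplication by the constant tuple σ carries the normalized fibre to the fibre over σ.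
  -- The two signs sgn(σ), from the wedge and from the coefficient, cancel, so each of the k! fibres
  -- contributes ω.
  have h : ∀ σ : Equiv.Perm (Fin k),
      ∑ π ∈ univ.filter (fun π : Fin d → Equiv.Perm (Fin k) => π 0 = σ),
        (tupleSign π : ℂ) • diagForm π = omega d k := by
    intro σ
    rw [omega_eq_sum_diagForm]
    symm
    refine sum_bij' (fun π _ => π * fun _ => σ) (fun π _ => π * fun _ => σ⁻¹) ?_ ?_ ?_ ?_ ?_
    · simp +contextual
    · simp +contextual
    · intro π _
      funext ℓ
      simp
    · intro π _
      funext ℓ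
      simp
    · intro π _
      rw [diagForm_mul_const, tupleSign_mul, tupleSign_const hd, smul_smul, ← Int.cast_mul,
        mul_assoc, ← Units.val_mul, Int.units_mul_self, Units.val_one, mul_one]
  rw [sum_congr rfl fun σ _ => h σ, sum_const, card_univ, Fintype.card_perm, Fintype.card_fin,
    ← Nat.cast_smul_eq_nsmul ℂ]

/-! ### Raising operators on diagonals -/

theorem lieAct_ιMulti {V : Type*} [AddCommGroup V] [Module ℂ V] (A : V →ₗ[ℂ] V) (m : ℕ)
    (v : Fin m → V) :
    lieAct A (ExteriorAlgebra.ιMulti ℂ m v) =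
      ∑ j, ExteriorAlgebra.ιMulti ℂ m (Function.update v j (A (v j))) := by
  induction m with
  | zero => simp [lieAct_one]
  | succ m ih =>
    rw [ExteriorAlgebra.ιMulti_succ_apply, lieAct_mul, lieAct_ι, ih, Fin.sum_univ_succ, mul_sum]
    congr 1
    · rw [ExteriorAlgebra.ιMulti_succ_apply, Function.update_self]
      congr 2
    · refine sum_congr rfl fun j _ => ?_
      rw [ExteriorAlgebra.ιMulti_succ_apply, Function.update_of_ne (Fin.succ_ne_zero j).symm]
      congr 2
      funext i
      simp only [Matrix.vecTail, Function.comp_apply, Function.update_apply, Fin.succ_inj]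

/-- The cell `x` with its `ℓ`-th coordinate replaced by `i`. -/
def updCell {d k : ℕ} (x : Cell d k) (ℓ : Fin d) (i : Fin k) : Cell d k :=
  toLex (Function.update (ofLex x) ℓ i)

theorem coord_updCell {d k : ℕ} (x : Cell d k) (ℓ ℓ' : Fin d) (i : Fin k) :
    coord ℓ' (updCell x ℓ i) = if ℓ' = ℓ then i else coord ℓ' x := by
  simp [coord, updCell, Function.update_apply]

/-- The matrix unit `E_{i,j}` in direction `ℓ` as an endomorphism of `(ℂ^k)^{⊗ d}`. -/
def unitMap {d k : ℕ} (ℓ : Fin d) (i j : Fin k) : TensorSpace d k →ₗ[ℂ] TensorSpace d k :=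
  PiTensorProduct.map
    (Function.update (fun _ : Fin d => (LinearMap.id : (Fin k → ℂ) →ₗ[ℂ] (Fin k → ℂ))) ℓ
      (Matrix.toLin' (Matrix.single i j (1 : ℂ))))

theorem unitMap_basisTensor {d k : ℕ} (ℓ : Fin d) (i j : Fin k) (x : Cell d k) :
    unitMap ℓ i j (basisTensor x) =
      if coord ℓ x = j then basisTensor (updCell x ℓ i) else 0 := by
  rw [unitMap, basisTensor, PiTensorProduct.map_tprod]
  split_ifs with h
  · rw [basisTensor]
    congr 1
    funext ℓ'
    rw [coord_updCell]
    split_ifs with h'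
    · subst h'
      rw [Function.update_self, Matrix.toLin'_apply, h, Matrix.single_mulVec]
      ext m
      simp [Pi.single_apply, Function.update_apply]
    · rw [Function.update_of_ne h', LinearMap.id_apply]
  · refine MultilinearMap.map_coord_zero _ ℓ ?_
    rw [Function.update_self, Matrix.toLin'_apply, Matrix.single_mulVec]
    ext m
    simp [Function.update_apply, Ne.symm h]

/-- The tuple of permutations with `ρ` in direction `ℓ` and the identity elsewhere. -/
abbrev permAt {d k : ℕ} (ℓ : Fin d) (ρ : Equiv.Perm (Fin k)) : Fin d → Equiv.Perm (Fin k) :=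
  Pi.mulSingle ℓ ρ

theorem tupleSign_permAt {d k : ℕ} (ℓ : Fin d) (ρ : Equiv.Perm (Fin k)) :
    tupleSign (permAt ℓ ρ) = (Equiv.Perm.sign ρ : ℤ) := by
  rw [tupleSign, prod_eq_single ℓ]
  · simp
  · intro ℓ' _ h
    simp [h]
  · simp

theorem permAt_mul_apply_of_ne {d k : ℕ} {ℓ ℓ' : Fin d} (h : ℓ' ≠ ℓ) (ρ : Equiv.Perm (Fin k))
    (π : Fin d → Equiv.Perm (Fin k)) : (permAt ℓ ρ * π) ℓ' = π ℓ' := by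
  simp [h]

theorem permAt_mul_apply_self {d k : ℕ} (ℓ : Fin d) (ρ : Equiv.Perm (Fin k))
    (π : Fin d → Equiv.Perm (Fin k)) : (permAt ℓ ρ * π) ℓ = ρ * π ℓ := by
  simp

theorem updCell_updCell {d k : ℕ} (x : Cell d k) (ℓ : Fin d) (i j : Fin k) :
    updCell (updCell x ℓ i) ℓ j = updCell x ℓ j :=
  ofLex.injective (Function.update_idem _ _ _)

theorem updCell_diagCell {d k : ℕ} {ℓ : Fin d} {π : Fin d → Equiv.Perm (Fin k)} {m i : Fin k}
    (h : i = π ℓ m) : updCell (diagCell π m) ℓ i = diagCell π m := by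
  subst h
  exact ofLex.injective (Function.update_eq_self _ _)

theorem updCell_diagCell_permAt {d k : ℕ} {ℓ : Fin d} {ρ : Equiv.Perm (Fin k)}
    {π : Fin d → Equiv.Perm (Fin k)} {m i : Fin k} (h : i = ρ (π ℓ m)) :
    updCell (diagCell π m) ℓ i = diagCell (permAt ℓ ρ * π) m := by
  refine cell_ext fun ℓ' => ?_
  rw [coord_updCell, coord_diagCell, coord_diagCell]
  split_ifs with h'
  · rw [h', permAt_mul_apply_self, h, Equiv.Perm.mul_apply]
  · rw [permAt_mul_apply_of_ne h']

/-- Only the Leibniz term at the unique cell with ℓ-th coordinate j survives, so the sum collapses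
to a single wedge. -/
theorem raising_diagForm {d k : ℕ} (ℓ : Fin d) (i j : Fin k) (π : Fin d → Equiv.Perm (Fin k)) :
    raising ℓ i j (diagForm π) = ExteriorAlgebra.ιMulti ℂ k fun m =>
      basisTensor (updCell (diagCell π m) ℓ (if π ℓ m = j then i else π ℓ m)) := by
  have hr : raising ℓ i j = lieAct (unitMap (d := d) ℓ i j) := rfl
  rw [hr, diagForm, lieAct_ιMulti, sum_eq_single ((π ℓ).symm j)]
  · congr 1
    funext m
    rw [Function.update_apply, unitMap_basisTensor, coord_diagCell, Equiv.apply_symm_apply,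
      if_pos rfl]
    by_cases h : π ℓ m = j
    · rw [if_pos h, if_pos ((π ℓ).eq_symm_apply.2 h), (π ℓ).symm_apply_eq.2 h.symm]
    · rw [if_neg h, if_neg (mt (π ℓ).eq_symm_apply.1 h), updCell_diagCell rfl]
  · intro m _ hm
    refine AlternatingMap.map_coord_zero _ m ?_
    rw [Function.update_self, unitMap_basisTensor, coord_diagCell, if_neg]
    exact fun h => hm ((π ℓ).eq_symm_apply.2 h)
  · simp

/-- The cells labelled i and j both end with label i, so exchanging the labels beforehand changes
nothing. -/
theorem raising_diagForm_swap {d k : ℕ} (ℓ : Fin d) (i j : Fin k)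
    (π : Fin d → Equiv.Perm (Fin k)) :
    raising ℓ i j (diagForm (permAt ℓ (Equiv.swap i j) * π)) = raising ℓ i j (diagForm π) := by
  rw [raising_diagForm, raising_diagForm]
  congr 1
  funext m
  rw [← updCell_diagCell_permAt rfl, updCell_updCell, permAt_mul_apply_self,
    Equiv.Perm.mul_apply]
  congr 2
  by_cases hi : π ℓ m = i
  · rw [hi, Equiv.swap_apply_left, if_pos rfl]
    split_ifs <;> rfl
  by_cases hj : π ℓ m = j
  · rw [hj, Equiv.swap_apply_right, if_pos rfl]
    split_ifs <;> rfl
  rw [Equiv.swap_apply_of_ne_of_ne hi hj]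

/-- After raising, exactly two factors carry label i in direction ℓ. Lowering the one that was
raised restores π; lowering the other gives the swapped diagonal. -/
theorem lowering_raising_diagForm {d k : ℕ} (ℓ : Fin d) {i j : Fin k} (hij : i ≠ j)
    (π : Fin d → Equiv.Perm (Fin k)) :
    raising ℓ j i (raising ℓ i j (diagForm π)) =
      diagForm π + diagForm (permAt ℓ (Equiv.swap i j) * π) := by
  have hr : raising ℓ j i = lieAct (unitMap (d := d) ℓ j i) := rfl
  have hne : (π ℓ).symm j ≠ (π ℓ).symm i := fun h => hij ((π ℓ).symm.injective h).symm
  rw [raising_diagForm, hr, lieAct_ιMulti, sum_eq_add ((π ℓ).symm j) ((π ℓ).symm i) hne]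
  · congr 1
    · rw [diagForm]
      congr 1
      funext m
      rw [Function.update_apply, unitMap_basisTensor, coord_updCell, if_pos rfl,
        Equiv.apply_symm_apply, if_pos rfl, if_pos rfl, updCell_updCell]
      by_cases h : π ℓ m = j
      · rw [if_pos ((π ℓ).eq_symm_apply.2 h), (π ℓ).symm_apply_eq.2 h.symm,
          updCell_diagCell h.symm]
      · rw [if_neg h, if_neg (mt (π ℓ).eq_symm_apply.1 h), updCell_diagCell rfl]
    · rw [diagForm]
      congr 1
      funext m
      rw [Function.update_apply, unitMap_basisTensor, coord_updCell, if_pos rfl,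
        Equiv.apply_symm_apply, if_neg hij, if_pos rfl, updCell_updCell]
      by_cases hi : π ℓ m = i
      · rw [if_pos ((π ℓ).eq_symm_apply.2 hi), (π ℓ).symm_apply_eq.2 hi.symm]
        congr 1
        exact updCell_diagCell_permAt (by rw [hi, Equiv.swap_apply_left])
      · rw [if_neg (mt (π ℓ).eq_symm_apply.1 hi)]
        congr 1
        by_cases hj : π ℓ m = j
        · rw [if_pos hj]
          exact updCell_diagCell_permAt (by rw [hj, Equiv.swap_apply_right])
        · rw [if_neg hj]
          exact updCell_diagCell_permAt (Equiv.swap_apply_of_ne_of_ne hi hj).symm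
  · rintro m _ ⟨h1, h2⟩
    refine AlternatingMap.map_coord_zero _ m ?_
    rw [Function.update_self, unitMap_basisTensor, coord_updCell, if_pos rfl, if_neg]
    rw [if_neg fun h => h1 ((π ℓ).eq_symm_apply.2 h)]
    exact fun h => h2 ((π ℓ).eq_symm_apply.2 h)
  · simp
  · simp

theorem raising_omega {d k : ℕ} [NeZero d] (hd : Odd d) (ℓ : Fin d) {i j : Fin k} (hij : i ≠ j) :
    raising ℓ i j (omega d k) = 0 := by
  have h : (k.factorial : ℂ) • raising ℓ i j (omega d k) =
      ∑ π, (tupleSign π : ℂ) • raising ℓ i j (diagForm π) := by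
    rw [← map_smul, factorial_smul_omega hd, map_sum]
    simp
  -- Substituting swap·π leaves the raised forms fixed and flips the signs, so the sum equals its
  -- own negative.
  have h2 : ∑ π, (tupleSign π : ℂ) • raising ℓ i j (diagForm π) =
      -∑ π, (tupleSign π : ℂ) • raising ℓ i j (diagForm (d := d) π) := by
    rw [← sum_neg_distrib, ← Equiv.sum_comp (Equiv.mulLeft (permAt ℓ (Equiv.swap i j)))]
    refine sum_congr rfl fun π _ => ?_
    rw [Equiv.coe_mulLeft, raising_diagForm_swap, tupleSign_mul, tupleSign_permAt,
      Equiv.Perm.sign_swap hij]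
    simp
  rw [eq_neg_iff_add_eq_zero, ← two_smul ℂ] at h2
  rw [(smul_eq_zero.1 h2).resolve_left two_ne_zero] at h
  exact (smul_eq_zero.1 h).resolve_left (by exact_mod_cast k.factorial_ne_zero)

/-! ### Weights -/

theorem act_ιMulti_basisTensor {d k m : ℕ} (a : Fin d → Fin k → ℂ) (f : Fin m → Cell d k) :
    act (fun ℓ => Matrix.diagonal (a ℓ)) (ExteriorAlgebra.ιMulti ℂ m fun i => basisTensor (f i)) =
      (∏ i, ∏ ℓ, a ℓ (coord ℓ (f i))) •
        ExteriorAlgebra.ιMulti ℂ m fun i => basisTensor (f i) := by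
  rw [act, ExteriorAlgebra.map_apply_ιMulti, ← AlternatingMap.coe_multilinearMap,
    ← MultilinearMap.map_smul_univ]
  congr 1
  funext i
  rw [Function.comp_apply, basisTensor, PiTensorProduct.map_tprod, ← MultilinearMap.map_smul_univ]
  congr 1
  funext ℓ
  rw [Matrix.toLin'_apply, Matrix.diagonal_mulVec_single, ← Pi.single_smul]
  simp

theorem hasWeight_omega (d k : ℕ) : HasWeight (fun _ _ => 1) (omega d k) := by
  intro a
  rw [omega, map_sum, smul_sum]
  refine sum_congr rfl fun π _ => ?_
  rw [map_smul, act_ιMulti_basisTensor, smul_comm, prod_comm]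
  congr 3
  funext ℓ
  simp only [zpow_one]
  exact Equiv.prod_comp (π ℓ) fun i => (a ℓ i : ℂ)

theorem isHighestWeightVector_smul_omega {d k : ℕ} [NeZero d] (hd : Odd d) {c : ℂ} (hc : c ≠ 0) :
    IsHighestWeightVector (c • omega d k) ∧ HasWeight (fun _ _ => 1) (c • omega d k) := by
  have hw : HasWeight (fun _ _ => 1) (c • omega d k) := fun a => by
    rw [map_smul, hasWeight_omega d k a, smul_comm]
  refine ⟨⟨smul_ne_zero hc omega_ne_zero, ⟨_, hw⟩, fun ℓ i j hij => ?_⟩, hw⟩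
  rw [map_smul, raising_omega hd ℓ hij.ne, smul_zero]

theorem act_psi {d k : ℕ} (a : Fin d → Fin k → ℂ) (P : Finset (Cell d k)) :
    act (fun ℓ => Matrix.diagonal (a ℓ)) (psi P) =
      (∏ ℓ, ∏ i, a ℓ i ^ (sliceOf P ℓ i).card) • psi P := by
  rw [psi, act_ιMulti_basisTensor, prod_comm]
  congr 2
  funext ℓ
  rw [prod_congr rfl fun i _ => (prod_const (a ℓ i)).symm]
  have h1 : ∏ x ∈ P, a ℓ (coord ℓ x) = ∏ i, ∏ x ∈ sliceOf P ℓ i, a ℓ i := by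
    rw [← prod_fiberwise P (coord ℓ)]
    refine prod_congr rfl fun i _ => prod_congr rfl fun x hx => ?_
    rw [(mem_filter.1 hx).2]
  rw [← h1, ← prod_coe_sort P]
  exact Equiv.prod_comp (P.orderIsoOfFin rfl).toEquiv fun x => a ℓ (coord ℓ x.1)

theorem mem_weightB_of_hasWeight {d k : ℕ} [NeZero d] {v : Forms d k}
    (hv : HasWeight (fun _ _ => 1) v) : v ∈ weightB d k 1 := by
  rw [← (formBasis d k).sum_repr v]
  refine Submodule.sum_mem _ fun P _ => ?_
  rw [formBasis_apply]
  by_cases h0 : (formBasis d k).repr v P = 0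
  · rw [h0, zero_smul]
    exact Submodule.zero_mem _
  refine Submodule.smul_mem _ _ (Submodule.subset_span ⟨P, ?_, rfl⟩)
  rw [mem_coe, mem_magicSets]
  intro ℓ i
  -- Scaling a single coordinate vector by 2 tests one slice: ψ_P is multiplied by 2 to the slice
  -- size, v by 2, so a nonzero coefficient at P forces slice size 1.
  let a : Fin d → Fin k → ℂˣ := Pi.mulSingle ℓ (Pi.mulSingle i (Units.mk0 2 two_ne_zero))
  have hcoord : (formBasis d k).coord P ∘ₗ
        (act fun ℓ => Matrix.diagonal fun i => (a ℓ i : ℂ)).toLinearMap =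
      (∏ ℓ, ∏ i, (a ℓ i : ℂ) ^ (sliceOf P ℓ i).card) • (formBasis d k).coord P := by
    refine (formBasis d k).ext fun Q => ?_
    simp only [LinearMap.comp_apply, AlgHom.toLinearMap_apply, LinearMap.smul_apply]
    rw [formBasis_apply, act_psi, map_smul, ← formBasis_apply, Module.Basis.coord_apply,
      Module.Basis.repr_self]
    by_cases h : Q = P
    · rw [h]
    · rw [Finsupp.single_eq_of_ne' h, smul_zero, smul_zero]
  have hev : ∀ e : Fin d → Fin k → ℕ,
      (∏ ℓ, ∏ i, (a ℓ i : ℂ) ^ e ℓ i) = 2 ^ e ℓ i := by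
    intro e
    rw [prod_eq_single ℓ, prod_eq_single i]
    · simp [a]
    · intro i' _ h
      simp [a, h]
    · simp
    · intro ℓ' _ h
      simp [a, h]
    · simp
  have h1 := LinearMap.congr_fun hcoord v
  have hva := hv a
  have hone : (∏ ℓ, ∏ i, (a ℓ i : ℂ) ^ (1 : ℤ)) = 2 := by
    simpa using hev fun _ _ => 1
  rw [hone] at hva
  rw [LinearMap.comp_apply, AlgHom.toLinearMap_apply, hva, LinearMap.smul_apply, hev, map_smul,
    Module.Basis.coord_apply, smul_eq_mul, smul_eq_mul] at h1
  have h2 := mul_right_cancel₀ h0 h1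
  have h3 : (2 : ℕ) ^ 1 = 2 ^ (sliceOf P ℓ i).card := by exact_mod_cast (pow_one (2 : ℂ)).trans h2
  exact (Nat.pow_right_injective le_rfl h3).symm

/-! ### Uniqueness of the highest weight vector -/

/-- The action of a tuple of permutations on the exterior algebra. -/
def permAct {d k : ℕ} (σ : Fin d → Equiv.Perm (Fin k)) : Forms d k →ₗ[ℂ] Forms d k :=
  (ExteriorAlgebra.map
    (PiTensorProduct.map fun ℓ => LinearMap.funLeft ℂ ℂ (σ ℓ).symm)).toLinearMap

theorem permAct_diagForm {d k : ℕ} (σ π : Fin d → Equiv.Perm (Fin k)) :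
    permAct σ (diagForm π) = diagForm (σ * π) := by
  rw [permAct, AlgHom.toLinearMap_apply, diagForm, ExteriorAlgebra.map_apply_ιMulti, diagForm]
  congr 1
  funext i
  rw [Function.comp_apply, basisTensor, PiTensorProduct.map_tprod, basisTensor]
  congr 1
  funext ℓ
  ext m
  -- Precomposition with the inverse of σ sends the basis vector at m to the one at σ m.
  simp [LinearMap.funLeft_apply, Pi.single_apply, Equiv.symm_apply_eq]

section Uniqueness

variable {d k : ℕ} [NeZero d] {v : Forms d k}

theorem eqOn_weightB_one {f g : Forms d k →ₗ[ℂ] Forms d k}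
    (h : ∀ π : Fin d → Equiv.Perm (Fin k), f (diagForm π) = g (diagForm π))
    (hv : v ∈ weightB d k 1) : f v = g v := by
  rw [weightB_one_eq_span] at hv
  refine LinearMap.eqOn_span (f := f) (g := g) ?_ hv
  rintro _ ⟨π, -, rfl⟩
  exact h π

/-- By `lowering_raising_diagForm`, lowering after raising is 1 + swap on B(1). Since v is killed by
raising, every transposition in one direction negates v; transpositions generate, and both sides are
multiplicative. -/
theorem permAct_eq_smul (hv : v ∈ weightB d k 1)
    (hr : ∀ (ℓ : Fin d) (i j : Fin k), i < j → raising ℓ i j v = 0)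
    (σ : Fin d → Equiv.Perm (Fin k)) : permAct σ v = (tupleSign σ : ℂ) • v := by
  have hone : permAct 1 v = (tupleSign (1 : Fin d → Equiv.Perm (Fin k)) : ℂ) • v := by
    have h := eqOn_weightB_one (f := permAct 1) (g := LinearMap.id)
      (fun π => by rw [permAct_diagForm, one_mul, LinearMap.id_apply]) hv
    simpa [tupleSign] using h
  have hmul : ∀ σ τ : Fin d → Equiv.Perm (Fin k), permAct σ v = (tupleSign σ : ℂ) • v →
      permAct τ v = (tupleSign τ : ℂ) • v → permAct (σ * τ) v = (tupleSign (σ * τ) : ℂ) • v := by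
    intro σ τ hσ hτ
    have h := eqOn_weightB_one (f := permAct (σ * τ)) (g := permAct σ ∘ₗ permAct τ)
      (fun π => by
        rw [LinearMap.comp_apply, permAct_diagForm, permAct_diagForm, permAct_diagForm, mul_assoc])
      hv
    rw [h, LinearMap.comp_apply, hτ, map_smul, hσ, smul_smul, tupleSign_mul, Int.cast_mul,
      mul_comm]
  have hswap : ∀ (ℓ : Fin d) (i j : Fin k), i < j → permAct (permAt ℓ (Equiv.swap i j)) v =
      (tupleSign (permAt ℓ (Equiv.swap i j)) : ℂ) • v := by
    intro ℓ i j hij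
    have h := eqOn_weightB_one (f := raising ℓ j i ∘ₗ raising ℓ i j)
      (g := LinearMap.id + permAct (permAt ℓ (Equiv.swap i j)))
      (fun π => by
        rw [LinearMap.comp_apply, LinearMap.add_apply, LinearMap.id_apply, permAct_diagForm,
          lowering_raising_diagForm ℓ hij.ne]) hv
    rw [LinearMap.comp_apply, hr ℓ i j hij, map_zero, LinearMap.add_apply, LinearMap.id_apply] at h
    rw [tupleSign_permAt, Equiv.Perm.sign_swap hij.ne, ← neg_eq_of_add_eq_zero_right h.symm]
    simp
  have hsingle : ∀ (ℓ : Fin d) (ρ : Equiv.Perm (Fin k)),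
      permAct (permAt ℓ ρ) v = (tupleSign (permAt ℓ ρ) : ℂ) • v := by
    intro ℓ ρ
    induction ρ using Equiv.Perm.swap_induction_on with
    | one => rwa [permAt, Pi.mulSingle_one]
    | swap_mul ρ i j hij ih =>
      rw [permAt, Pi.mulSingle_mul]
      refine hmul _ _ ?_ ih
      rcases hij.lt_or_gt with h | h
      · exact hswap ℓ i j h
      · rw [Equiv.swap_comm]
        exact hswap ℓ j i h
  -- The tuple is assembled one direction at a time.
  have hset : ∀ s : Finset (Fin d), permAct (fun ℓ => if ℓ ∈ s then σ ℓ else 1) v =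
      (tupleSign (fun ℓ => if ℓ ∈ s then σ ℓ else 1) : ℂ) • v := by
    intro s
    induction s using Finset.induction_on with
    | empty => simpa [Pi.one_def] using hone
    | insert ℓ s hℓ ih =>
      have h : (fun ℓ' => if ℓ' ∈ insert ℓ s then σ ℓ' else 1) =
          permAt ℓ (σ ℓ) * fun ℓ' => if ℓ' ∈ s then σ ℓ' else 1 := by
        funext ℓ'
        by_cases h : ℓ' = ℓ
        · subst h
          simp [hℓ]
        · simp [h]
      rw [h]
      exact hmul _ _ (hsingle _ _) ih
  simpa using hset univ

/-- The antisymmetrizer N multiplies v by the order of S_k^d, because signs square to 1, yet it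
sends every diagonal to a multiple of ω. -/
theorem exists_eq_smul_omega (hd : Odd d) (hv : v ∈ weightB d k 1)
    (hr : ∀ (ℓ : Fin d) (i j : Fin k), i < j → raising ℓ i j v = 0) :
    ∃ c : ℂ, v = c • omega d k := by
  let N : Forms d k →ₗ[ℂ] Forms d k :=
    ∑ σ : Fin d → Equiv.Perm (Fin k), (tupleSign σ : ℂ) • permAct σ
  have hN : N v = (Fintype.card (Fin d → Equiv.Perm (Fin k)) : ℂ) • v := by
    simp only [N, LinearMap.sum_apply, LinearMap.smul_apply, permAct_eq_smul hv hr, smul_smul,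
      ← Int.cast_mul, tupleSign_mul_self, Int.cast_one, one_smul, sum_const, card_univ]
    rw [Nat.cast_smul_eq_nsmul]
  have hspan : N v ∈ Submodule.span ℂ {omega d k} := by
    clear hN hr
    rw [weightB_one_eq_span] at hv
    induction hv using Submodule.span_induction with
    | zero => simp
    | add x y _ _ hx hy => rw [map_add]; exact Submodule.add_mem _ hx hy
    | smul c x _ hx => rw [map_smul]; exact Submodule.smul_mem _ _ hx
    | mem x hx =>
      obtain ⟨π, -, rfl⟩ := hx
      have h : N (diagForm π) = (tupleSign π : ℂ) • (k.factorial : ℂ) • omega d k := by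
        -- Replacing σ by σπ in the full signed sum produces N applied to the diagonal of π, up to
        -- the sign of π.
        rw [factorial_smul_omega hd, ← Equiv.sum_comp (Equiv.mulRight π), smul_sum]
        simp only [N, LinearMap.sum_apply, LinearMap.smul_apply, permAct_diagForm]
        refine sum_congr rfl fun σ _ => ?_
        rw [Equiv.coe_mulRight, smul_smul, tupleSign_mul, ← Int.cast_mul, mul_left_comm,
          tupleSign_mul_self, mul_one]
      rw [h]
      exact Submodule.smul_mem _ _ (Submodule.smul_mem _ _ (Submodule.mem_span_singleton_self _))
  obtain ⟨c, hc⟩ := Submodule.mem_span_singleton.1 hspan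
  refine ⟨(Fintype.card (Fin d → Equiv.Perm (Fin k)) : ℂ)⁻¹ * c, ?_⟩
  rw [mul_smul, hc, hN, inv_smul_smul₀]
  exact_mod_cast Fintype.card_ne_zero

end Uniqueness

/-! ### Products of monomials -/

open scoped Classical in
-- The new factor moves past exactly the cells of Q smaller than a.
theorem ι_mul_psi {d k : ℕ} {a : Cell d k} {Q : Finset (Cell d k)} (ha : a ∉ Q) :
    ExteriorAlgebra.ι ℂ (basisTensor a) * psi Q =
      (-1 : ℂ) ^ (Q.filter (· < a)).card • psi (insert a Q) := by
  induction Q using Finset.induction_on_min with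
  | empty => rw [psi_insert_min (by simp)]; simp
  | insert b Q hb ih =>
    have hbQ : b ∉ Q := fun h => lt_irrefl _ (hb b h)
    simp only [mem_insert, not_or] at ha
    rcases lt_or_gt_of_ne ha.1 with hab | hab
    · have hmin : ∀ x ∈ insert b Q, a < x := by
        simp only [mem_insert, forall_eq_or_imp]
        exact ⟨hab, fun x hx => hab.trans (hb x hx)⟩
      have hf : (insert b Q).filter (· < a) = ∅ :=
        filter_eq_empty_iff.2 fun x hx => (hmin x hx).not_gt
      rw [psi_insert_min hmin, hf]
      simp
    · have hmin : ∀ x ∈ insert a Q, b < x := by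
        simp only [mem_insert, forall_eq_or_imp]
        exact ⟨hab, hb⟩
      have hf : (insert b Q).filter (· < a) = insert b (Q.filter (· < a)) := by
        rw [filter_insert]
        exact if_pos hab
      have hswap := eq_neg_of_add_eq_zero_left
        (ExteriorAlgebra.ι_add_mul_swap (R := ℂ) (basisTensor a) (basisTensor b))
      rw [psi_insert_min hb, ← mul_assoc, hswap, neg_mul, mul_assoc, ih ha.2, insert_comm,
        psi_insert_min hmin, hf, card_insert_of_notMem (by simp [hbQ]),
        pow_succ, mul_smul_comm, mul_neg_one, neg_smul]

open scoped Classical in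
theorem psi_mul_psi {d k : ℕ} {P Q : Finset (Cell d k)} (h : Disjoint P Q) :
    psi P * psi Q =
      (-1 : ℂ) ^ ((P ×ˢ Q).filter fun p => p.2 < p.1).card • psi (P ∪ Q) := by
  induction P using Finset.induction_on_min with
  | empty => simp [psi_empty]
  | insert a P ha ih =>
    have haP : a ∉ P := fun h => lt_irrefl _ (ha a h)
    rw [disjoint_insert_left] at h
    rw [psi_insert_min ha, mul_assoc, ih h.2, mul_smul_comm, ι_mul_psi (by simp [haP, h.1]),
      smul_smul, ← pow_add, insert_union]
    congr 2
    have hf : P.filter (· < a) = ∅ := filter_eq_empty_iff.2 fun x hx => (ha x hx).not_gt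
    rw [filter_union, hf, empty_union,
      insert_eq, union_product, filter_union, card_union_of_disjoint, add_comm]
    · congr 1
      rw [singleton_product, filter_map, card_map]
      rfl
    · refine disjoint_filter_filter (disjoint_product.2 (Or.inl ?_))
      simpa using haP

theorem exists_psi_mul_psi_eq_smul {d k : ℕ} (P Q : Finset (Cell d k)) :
    ∃ c : ℂ, psi P * psi Q = c • psi (P ∪ Q) := by
  by_cases h : Disjoint P Q
  · exact ⟨_, psi_mul_psi h⟩
  · exact ⟨0, by rw [psi_mul_of_not_disjoint h, zero_smul]⟩

theorem biUnion_univ_succ {d k n : ℕ} (P : Fin (n + 1) → Finset (Cell d k)) :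
    univ.biUnion P = P 0 ∪ univ.biUnion fun j : Fin n => P j.succ := by
  ext x
  simp [Fin.exists_fin_succ]

theorem exists_prod_psi_eq_smul {d k n : ℕ} (P : Fin n → Finset (Cell d k)) :
    ∃ c : ℂ, (List.ofFn fun j => psi (P j)).prod = c • psi (univ.biUnion P) := by
  induction n with
  | zero => exact ⟨1, by simp [psi_empty]⟩
  | succ n ih =>
    obtain ⟨c, hc⟩ := ih fun j => P j.succ
    obtain ⟨c', hc'⟩ := exists_psi_mul_psi_eq_smul (P 0) (univ.biUnion fun j : Fin n => P j.succ)
    refine ⟨c * c', ?_⟩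
    rw [List.ofFn_succ, List.prod_cons, hc, mul_smul_comm, hc', smul_smul, biUnion_univ_succ P]

/-- A repeated cell kills the wedge. If the tail is disjoint, it collapses to a multiple of the
monomial of its union, which then meets the first set; otherwise induction applies. -/
theorem prod_psi_eq_zero {d k n : ℕ} {P : Fin n → Finset (Cell d k)}
    (h : ¬Pairwise fun i j => Disjoint (P i) (P j)) :
    (List.ofFn fun j => psi (P j)).prod = 0 := by
  induction n with
  | zero => exact absurd (fun i => i.elim0) h
  | succ n ih =>
    rw [List.ofFn_succ, List.prod_cons]
    by_cases hs : Pairwise fun i j : Fin n => Disjoint (P i.succ) (P j.succ)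
    · obtain ⟨c, hc⟩ := exists_prod_psi_eq_smul fun j : Fin n => P j.succ
      rw [hc, mul_smul_comm, psi_mul_of_not_disjoint, smul_zero]
      intro h0
      rw [disjoint_biUnion_right] at h0
      refine h fun i j hij => ?_
      induction i using Fin.cases with
      | zero =>
        induction j using Fin.cases with
        | zero => exact absurd rfl hij
        | succ j => exact h0 j (mem_univ j)
      | succ i =>
        induction j using Fin.cases with
        | zero => exact (h0 i (mem_univ i)).symm
        | succ j => exact hs fun hij' => hij (congrArg Fin.succ hij')
    · rw [ih hs, mul_zero]

open scoped Classical in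
/-- The wedge product of the monomials of the colour classes of `c` is, up to the sign of the
sequence of colours, the monomial of their union. -/
theorem prod_psi_eq_msgn_smul {d k n : ℕ} {α : Type*} [LinearOrder α]
    {P : Fin n → Finset (Cell d k)} (c : Cell d k → α) (e : Fin n → α) (he : StrictMono e)
    (h : ∀ j, ∀ x ∈ P j, c x = e j) :
    (List.ofFn fun j => psi (P j)).prod =
      (msgn (univ.biUnion P) c : ℂ) • psi (univ.biUnion P) := by
  induction n with
  | zero => simp [psi_empty, msgn, inv]
  | succ n ih =>
    set U := univ.biUnion fun j : Fin n => P j.succ with hU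
    have hlt : ∀ x ∈ P 0, ∀ y ∈ U, c x < c y := by
      intro x hx y hy
      obtain ⟨j, -, hj⟩ := mem_biUnion.1 hy
      rw [h 0 x hx, h _ y hj]
      exact he (Fin.succ_pos j)
    have hdisj : Disjoint (P 0) U := disjoint_left.2 fun x hx hx' => lt_irrefl _ (hlt x hx x hx')
    rw [List.ofFn_succ, List.prod_cons, ih (fun j => e j.succ)
      (fun i j hij => he (Fin.succ_lt_succ_iff.2 hij)) fun j => h j.succ, mul_smul_comm,
      psi_mul_psi hdisj, smul_smul, biUnion_univ_succ P]
    congr 1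
    simp only [msgn, Int.cast_pow, Int.cast_neg, Int.cast_one]
    rw [← pow_add]
    congr 1
    -- All of `P 0` has one colour, smaller than every colour in U. The colour inversions are thus
    -- those inside U together with the pairs where a cell of U precedes one of `P 0`, and the
    -- latter are the sign exponent of `psi_mul_psi`.
    have hset : ((P 0 ∪ U) ×ˢ (P 0 ∪ U)).filter (fun p => p.1 < p.2 ∧ c p.2 < c p.1) =
        ((U ×ˢ U).filter fun p => p.1 < p.2 ∧ c p.2 < c p.1) ∪
          (((P 0 ×ˢ U).filter fun p => p.2 < p.1).map (Equiv.prodComm _ _).toEmbedding) := by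
      ext ⟨x, y⟩
      simp only [mem_filter, mem_product, mem_union, mem_map_equiv, Equiv.prodComm_symm,
        Equiv.prodComm_apply, Prod.swap_prod_mk]
      constructor
      · rintro ⟨⟨hx, hy⟩, hxy, hc⟩
        rcases hx with hx | hx
        · rcases hy with hy | hy
          · rw [h 0 x hx, h 0 y hy] at hc
            exact absurd hc (lt_irrefl _)
          · exact absurd hc (hlt x hx y hy).not_gt
        · rcases hy with hy | hy
          · exact Or.inr ⟨⟨hy, hx⟩, hxy⟩
          · exact Or.inl ⟨⟨hx, hy⟩, hxy, hc⟩
      · rintro (⟨⟨hx, hy⟩, hxy, hc⟩ | ⟨⟨hy, hx⟩, hxy⟩)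
        · exact ⟨⟨Or.inr hx, Or.inr hy⟩, hxy, hc⟩
        · exact ⟨⟨Or.inr hx, Or.inl hy⟩, hxy, hlt y hy x hx⟩
    rw [inv, inv, filter_congr_decidable, hset, card_union_of_disjoint, card_map]
    · rw [disjoint_left]
      rintro ⟨x, y⟩ h1 h2
      simp only [mem_filter, mem_product, mem_map_equiv, Equiv.prodComm_symm,
        Equiv.prodComm_apply, Prod.swap_prod_mk] at h1 h2
      exact disjoint_left.1 hdisj h2.1.1 h1.1.2

theorem sum_pow_eq_sum_piFinset {ι R : Type*} [DecidableEq ι] [Semiring R] (s : Finset ι)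
    (f : ι → R) (n : ℕ) :
    (∑ i ∈ s, f i) ^ n =
      ∑ p ∈ Fintype.piFinset fun _ : Fin n => s, (List.ofFn fun j => f (p j)).prod := by
  induction n with
  | zero => simp
  | succ n ih =>
    rw [pow_succ', ih, sum_mul_sum, ← sum_product']
    refine sum_bij' (fun p _ => Fin.cons p.1 p.2) (fun p _ => (p 0, Fin.tail p)) ?_ ?_ ?_ ?_ ?_
    · rintro ⟨i, p⟩ hp
      simp only [mem_product, Fintype.mem_piFinset] at hp ⊢
      exact Fin.cases hp.1 hp.2
    · intro p hp
      simp only [mem_product, Fintype.mem_piFinset] at hp ⊢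
      exact ⟨hp 0, fun j => hp j.succ⟩
    · rintro ⟨i, p⟩ _
      simp
    · intro p _
      simp
    · rintro ⟨i, p⟩ _
      simp [List.ofFn_succ]

theorem prod_ofFn_smul {R A : Type*} [CommSemiring R] [Semiring A] [Algebra R A] {n : ℕ}
    (c : Fin n → R) (x : Fin n → A) :
    (List.ofFn fun j => c j • x j).prod = (∏ j, c j) • (List.ofFn x).prod := by
  induction n with
  | zero => simp
  | succ n ih =>
    rw [List.ofFn_succ, List.prod_cons, ih, smul_mul_smul_comm, ← Fin.prod_univ_succ,
      List.ofFn_succ, List.prod_cons]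

theorem omega_pow {d k : ℕ} [NeZero d] (n : ℕ) :
    omega d k ^ n = ∑ P ∈ Fintype.piFinset fun _ : Fin n => magicSets d k 1,
      ((∏ j, setSign (P j) : ℤ) : ℂ) • (List.ofFn fun j => psi (P j)).prod := by
  rw [omega_eq_sum_psi, sum_pow_eq_sum_piFinset]
  refine sum_congr rfl fun P _ => ?_
  rw [prod_ofFn_smul, Int.cast_prod]

/-! ### Odd forms square to zero -/

theorem ι_mul_ιMulti {V : Type*} [AddCommGroup V] [Module ℂ V] (v : V) {m : ℕ} (f : Fin m → V) :
    ExteriorAlgebra.ι ℂ v * ExteriorAlgebra.ιMulti ℂ m f =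
      (-1 : ℂ) ^ m • (ExteriorAlgebra.ιMulti ℂ m f * ExteriorAlgebra.ι ℂ v) := by
  induction m with
  | zero => simp
  | succ m ih =>
    rw [ExteriorAlgebra.ιMulti_succ_apply, ← mul_assoc,
      eq_neg_of_add_eq_zero_left (ExteriorAlgebra.ι_add_mul_swap (R := ℂ) v (f 0)), neg_mul,
      mul_assoc, ih, mul_smul_comm, pow_succ, mul_neg_one, neg_smul, mul_assoc]

theorem ιMulti_mul_comm {V : Type*} [AddCommGroup V] [Module ℂ V] {m n : ℕ} (f : Fin m → V)
    (g : Fin n → V) :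
    ExteriorAlgebra.ιMulti ℂ m f * ExteriorAlgebra.ιMulti ℂ n g = (-1 : ℂ) ^ (m * n) •
      (ExteriorAlgebra.ιMulti ℂ n g * ExteriorAlgebra.ιMulti ℂ m f) := by
  induction m with
  | zero => simp
  | succ m ih =>
    rw [ExteriorAlgebra.ιMulti_succ_apply, mul_assoc, ih, mul_smul_comm, ← mul_assoc,
      ι_mul_ιMulti, smul_mul_assoc, smul_smul, ← pow_add, mul_assoc, Nat.succ_mul]

/-- Two wedges of odd length k commute up to (-1)^(k·k) = -1, so ω² = -ω². -/
theorem omega_sq_eq_zero (d : ℕ) {k : ℕ} (hk : Odd k) : omega d k ^ 2 = 0 := by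
  have h : omega d k * omega d k = -(omega d k * omega d k) := by
    conv_lhs => rw [omega, sum_mul_sum, sum_comm]
    conv_rhs => rw [omega, sum_mul_sum, ← sum_neg_distrib]
    refine sum_congr rfl fun π _ => ?_
    rw [← sum_neg_distrib]
    refine sum_congr rfl fun ρ _ => ?_
    rw [smul_mul_smul_comm, ιMulti_mul_comm, (hk.mul hk).neg_one_pow, neg_one_smul, smul_neg,
      smul_mul_smul_comm, mul_comm]
  rw [eq_neg_iff_add_eq_zero, ← two_smul ℂ] at h
  rw [pow_two]
  exact (smul_eq_zero.1 h).resolve_left two_ne_zero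

/-! ### Signs of colourings -/

open scoped Classical in
theorem msgn_eq_prod {d k : ℕ} {α : Type*} [LinearOrder α] (S : Finset (Cell d k))
    (f : Cell d k → α) :
    msgn S f = ∏ p ∈ (S ×ˢ S).filter fun p => p.1 < p.2, if f p.2 < f p.1 then -1 else 1 := by
  rw [← prod_filter, prod_const, filter_filter, msgn, inv, filter_congr_decidable]

open scoped Classical in
theorem prod_msgn_fiber {d k : ℕ} {α κ : Type*} [LinearOrder α] [Fintype κ] [DecidableEq κ]
    (S : Finset (Cell d k)) (f : Cell d k → α) (g : Cell d k → κ) :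
    ∏ i, msgn (S.filter fun x => g x = i) f = ∏ p ∈ (S ×ˢ S).filter fun p => p.1 < p.2,
      if g p.1 = g p.2 ∧ f p.2 < f p.1 then -1 else 1 := by
  rw [← prod_filter, prod_const, filter_filter]
  simp only [msgn]
  rw [prod_pow_eq_pow_sum,
    card_eq_sum_card_fiberwise (f := fun p : Cell d k × Cell d k => g p.1) (t := univ) (by simp)]
  congr 1
  refine sum_congr rfl fun i _ => ?_
  rw [inv, filter_filter]
  congr 1
  ext p
  simp only [mem_filter, mem_product]
  constructor
  · rintro ⟨⟨⟨h1, h2⟩, h3, h4⟩, h5, h6⟩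
    exact ⟨⟨h1, h3⟩, ⟨h5, h2.trans h4.symm, h6⟩, h2⟩
  · rintro ⟨⟨h1, h3⟩, ⟨h5, h6, h7⟩, h2⟩
    exact ⟨⟨⟨h1, h2⟩, h3, h6 ▸ h2⟩, h5, h7⟩

/-- The sign of the permutation exchanging the two lexicographic orders of a `k × n` grid. -/
def gridSign (k n : ℕ) : ℤ :=
  (-1) ^ ((univ : Finset ((Fin k × Fin (n + 1)) × (Fin k × Fin (n + 1)))).filter fun a =>
    (a.1.2 ≠ 0 ∧ a.2.2 ≠ 0) ∧ a.1.1 < a.2.1 ∧ a.2.2 < a.1.2).card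

open scoped Classical in
-- The first bracket is the sign of sorting T by (u, c), the second that of sorting by (c, u). Their
-- product compares the two lexicographic orders of the grid of pairs (u, c), so it no longer
-- depends on T.
theorem msgn_mul_fiber_eq {d k n : ℕ} {T : Finset (Cell d k)} {u : Cell d k → Fin k}
    {c : Cell d k → Fin (n + 1)}
    (h : Set.BijOn (fun x => (u x, c x)) (T : Set (Cell d k)) {a | a.2 ≠ 0}) :
    (msgn T u * ∏ i, msgn (T.filter fun x => u x = i) c) *
      (msgn T c * ∏ j, msgn (T.filter fun x => c x = j) u) = gridSign k n := by
  rw [prod_msgn_fiber, prod_msgn_fiber, msgn_eq_prod, msgn_eq_prod, ← prod_mul_distrib,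
    ← prod_mul_distrib, ← prod_mul_distrib]
  -- A pair of cells contributes -1 exactly when u and c order it strictly oppositely.
  have hpt : ∀ p ∈ (T ×ˢ T).filter fun p => p.1 < p.2,
      (((if u p.2 < u p.1 then -1 else 1) *
          if u p.1 = u p.2 ∧ c p.2 < c p.1 then -1 else 1) *
        ((if c p.2 < c p.1 then -1 else 1) *
          if c p.1 = c p.2 ∧ u p.2 < u p.1 then -1 else 1) : ℤ) =
      if (u p.1 < u p.2 ∧ c p.2 < c p.1) ∨ (u p.2 < u p.1 ∧ c p.1 < c p.2) then -1 else 1 := by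
    intro p _
    split_ifs <;> omega
  rw [prod_congr rfl hpt, ← prod_filter, prod_const, filter_filter, gridSign]
  congr 1
  -- Each such pair of cells is reoriented so that the smaller u comes first, as in the definition
  -- of `gridSign`.
  refine card_bij (fun p _ => if u p.1 < u p.2 then ((u p.1, c p.1), (u p.2, c p.2)) else
    ((u p.2, c p.2), (u p.1, c p.1))) ?_ ?_ ?_
  · rintro ⟨x, y⟩ hp
    simp only [mem_filter, mem_product, mem_univ, true_and] at hp ⊢
    obtain ⟨⟨hx, hy⟩, -, hd⟩ := hp
    have hcx : c x ≠ 0 := h.mapsTo hx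
    have hcy : c y ≠ 0 := h.mapsTo hy
    rcases hd with hd | hd
    · rw [if_pos hd.1]
      exact ⟨⟨hcx, hcy⟩, hd⟩
    · rw [if_neg hd.1.not_gt]
      exact ⟨⟨hcy, hcx⟩, hd⟩
  · rintro ⟨x, y⟩ hp ⟨x', y'⟩ hp' heq
    simp only [mem_filter, mem_product] at hp hp' heq
    obtain ⟨⟨hx, hy⟩, hxy, -⟩ := hp
    obtain ⟨⟨hx', hy'⟩, hxy', -⟩ := hp'
    split_ifs at heq
    · rw [Prod.mk.injEq] at heq ⊢
      exact ⟨h.injOn hx hx' heq.1, h.injOn hy hy' heq.2⟩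
    · rw [Prod.mk.injEq] at heq
      have h1 := h.injOn hx hy' heq.1
      have h2 := h.injOn hy hx' heq.2
      subst h1 h2
      exact absurd hxy hxy'.not_gt
    · rw [Prod.mk.injEq] at heq
      have h1 := h.injOn hy hx' heq.1
      have h2 := h.injOn hx hy' heq.2
      subst h1 h2
      exact absurd hxy hxy'.not_gt
    · rw [Prod.mk.injEq] at heq ⊢
      exact ⟨h.injOn hx hx' heq.2, h.injOn hy hy' heq.1⟩
  · rintro ⟨a, b⟩ hab
    simp only [mem_filter, mem_univ, true_and] at hab
    obtain ⟨⟨ha, hb⟩, h1, h2⟩ := hab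
    obtain ⟨x, hx, rfl⟩ := h.surjOn ha
    obtain ⟨y, hy, rfl⟩ := h.surjOn hb
    simp only at h1 h2
    have hne : x ≠ y := fun hxy => by simp [hxy] at h1
    rcases lt_or_gt_of_ne hne with hxy | hxy
    · exact ⟨(x, y), by simpa using ⟨⟨hx, hy⟩, hxy, Or.inl ⟨h1, h2⟩⟩, by simp [h1]⟩
    · exact ⟨(y, x), by simpa using ⟨⟨hy, hx⟩, hxy, Or.inr ⟨h1, h2⟩⟩, by simp [h1.not_gt]⟩

theorem msgn_mul_self {d k : ℕ} {α : Type*} [LinearOrder α] (S : Finset (Cell d k))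
    (f : Cell d k → α) : msgn S f * msgn S f = 1 := by
  rw [msgn, ← mul_pow]
  simp

theorem pow_odd_of_mul_self {M : Type*} [Monoid M] {a : M} (h : a * a = 1) {d : ℕ} (hd : Odd d) :
    a ^ d = a := by
  obtain ⟨m, rfl⟩ := hd
  rw [pow_succ, pow_mul, pow_two, h, one_pow, one_mul]

theorem gridSign_mul_self (k n : ℕ) : gridSign k n * gridSign k n = 1 := by
  rw [gridSign, ← mul_pow]
  simp

theorem setSign_mul_self {d k : ℕ} (T : Finset (Cell d k)) : setSign T * setSign T = 1 := by
  rw [setSign, ← prod_mul_distrib]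
  exact prod_eq_one fun ℓ _ => msgn_mul_self _ _

/-! ### Powers of `ω` -/

/-- The set of cells of colour `j + 1`. -/
def colorClass {d k n : ℕ} (C : Cell d k → Fin (n + 1)) (j : Fin n) : Finset (Cell d k) :=
  univ.filter fun x => C x = j.succ

theorem mem_colorClass {d k n : ℕ} {C : Cell d k → Fin (n + 1)} {j : Fin n} {x : Cell d k} :
    x ∈ colorClass C j ↔ C x = j.succ := by
  simp [colorClass]

theorem colorClass_injective (d k n : ℕ) :
    Function.Injective (colorClass : (Cell d k → Fin (n + 1)) → Fin n → Finset (Cell d k)) := by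
  intro C C' h
  have hj : ∀ j x, C x = Fin.succ j ↔ C' x = Fin.succ j := fun j x => by
    rw [← mem_colorClass, ← mem_colorClass, h]
  funext x
  rcases Fin.eq_zero_or_eq_succ (C' x) with h0 | ⟨j, h0⟩
  · rcases Fin.eq_zero_or_eq_succ (C x) with h1 | ⟨j, h1⟩
    · rw [h0, h1]
    · rw [h1, (hj j x).1 h1]
  · rw [h0, (hj j x).2 h0]

theorem colorClass_pairwise_disjoint {d k n : ℕ} (C : Cell d k → Fin (n + 1)) :
    Pairwise fun i j => Disjoint (colorClass C i) (colorClass C j) := by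
  intro i j hij
  rw [disjoint_left]
  intro x hi hj
  rw [mem_colorClass] at hi hj
  exact hij (Fin.succ_injective n (hi.symm.trans hj))

theorem exists_colorClass_eq {d k n : ℕ} {P : Fin n → Finset (Cell d k)}
    (h : Pairwise fun i j => Disjoint (P i) (P j)) :
    ∃ C : Cell d k → Fin (n + 1), colorClass C = P := by
  classical
  refine ⟨fun x => if hx : ∃ j, x ∈ P j then hx.choose.succ else 0, ?_⟩
  funext j
  ext x
  rw [mem_colorClass]
  constructor
  · intro hx
    split_ifs at hx with hex
    · rw [← Fin.succ_injective n hx]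
      exact hex.choose_spec
    · exact absurd hx.symm (Fin.succ_ne_zero j)
  · intro hx
    have hex : ∃ j, x ∈ P j := ⟨j, hx⟩
    rw [dif_pos hex]
    congr 1
    by_contra hne
    exact disjoint_left.1 (h hne) hex.choose_spec hx

section PartialLatin

variable {d k n : ℕ}

theorem biUnion_colorClass {T : Finset (Cell d k)} {C : Cell d k → Fin (n + 1)}
    (hT : ∀ x, x ∈ T ↔ C x ≠ 0) : univ.biUnion (colorClass C) = T := by
  ext x
  rw [hT, ← Fin.exists_succ_eq]
  simp [mem_colorClass, eq_comm]

/-- A colouring is a partial Latin hypercube if and only if all its colour classes are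
diagonals. -/
theorem isPartialLatin_iff [NeZero d] {T : Finset (Cell d k)} {C : Cell d k → Fin (n + 1)} :
    IsPartialLatin T C ↔
      (∀ x, x ∈ T ↔ C x ≠ 0) ∧ ∀ j, colorClass C j ∈ magicSets d k 1 := by
  constructor
  · rintro ⟨-, hT, hB⟩
    refine ⟨hT, fun j => mem_magicSets.2 fun ℓ i => card_eq_one.2 ?_⟩
    obtain ⟨x, hx, hxj⟩ := (hB ℓ i).surjOn (Fin.succ_ne_zero j)
    refine ⟨x, eq_singleton_iff_unique_mem.2 ⟨?_, fun y hy => ?_⟩⟩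
    · exact mem_filter.2 ⟨mem_colorClass.2 hxj, (mem_filter.1 hx).2⟩
    · obtain ⟨hy1, hy2⟩ := mem_filter.1 hy
      rw [mem_colorClass] at hy1
      refine (hB ℓ i).injOn (mem_filter.2 ⟨(hT y).2 ?_, hy2⟩) hx (hy1.trans hxj.symm)
      rw [hy1]
      exact Fin.succ_ne_zero j
  · rintro ⟨hT, hP⟩
    have hB : ∀ (ℓ : Fin d) (i : Fin k),
        Set.BijOn C (sliceOf T ℓ i : Set (Cell d k)) {c | c ≠ 0} := by
      intro ℓ i
      refine ⟨fun x hx => (hT x).1 (mem_filter.1 hx).1, fun x hx y hy hxy => ?_, fun c hc => ?_⟩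
      · obtain ⟨hx1, hx2⟩ := mem_filter.1 hx
        obtain ⟨hy1, hy2⟩ := mem_filter.1 hy
        obtain ⟨j, hj⟩ := Fin.exists_succ_eq.2 ((hT x).1 hx1)
        exact card_le_one.1 (mem_magicSets.1 (hP j) ℓ i).le x
          (mem_filter.2 ⟨mem_colorClass.2 hj.symm, hx2⟩) y
          (mem_filter.2 ⟨mem_colorClass.2 (hxy.symm.trans hj.symm), hy2⟩)
      · obtain ⟨j, rfl⟩ := Fin.exists_succ_eq.2 hc
        obtain ⟨x, hx⟩ := card_pos.1 ((mem_magicSets.1 (hP j) ℓ i).symm ▸ one_pos)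
        obtain ⟨hx1, hx2⟩ := mem_filter.1 hx
        rw [mem_colorClass] at hx1
        refine ⟨x, mem_filter.2 ⟨(hT x).2 ?_, hx2⟩, hx1⟩
        rw [hx1]
        exact Fin.succ_ne_zero j
    refine ⟨mem_magicSets.2 fun ℓ i => ?_, hT, hB⟩
    -- A slice of T has as many cells as there are nonzero colours, namely n.
    have hcard := (hB ℓ i).injOn.ncard_image
    rw [(hB ℓ i).image_eq, Set.ncard_coe_finset] at hcard
    rw [← hcard, show {c : Fin (n + 1) | c ≠ 0} = ((univ.erase 0 : Finset (Fin (n + 1))) : Set _) by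
      ext; simp, Set.ncard_coe_finset]
    simp

/-- This is `msgn_mul_fiber_eq` for the pair (ℓ-th coordinate, colour); the signs square to 1 and
can be moved across the equation. -/
theorem msgn_mul_dirSign {T : Finset (Cell d k)} {C : Cell d k → Fin (n + 1)}
    (h : IsPartialLatin T C) (ℓ : Fin d) :
    msgn T (coord ℓ) * dirSign C ℓ =
      gridSign k n * (msgn T C * ∏ j, msgn (colorClass C j) (coord ℓ)) := by
  obtain ⟨-, hT, hB⟩ := h
  have hbij : Set.BijOn (fun x => (coord ℓ x, C x)) (T : Set (Cell d k)) {a | a.2 ≠ 0} := by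
    refine ⟨fun x hx => (hT x).1 hx, fun x hx y hy hxy => ?_, fun a ha => ?_⟩
    · rw [Prod.mk.injEq] at hxy
      exact (hB ℓ (coord ℓ y)).injOn (mem_filter.2 ⟨hx, hxy.1⟩) (mem_filter.2 ⟨hy, rfl⟩) hxy.2
    · obtain ⟨x, hx, hxa⟩ := (hB ℓ a.1).surjOn ha
      exact ⟨x, (mem_filter.1 hx).1, Prod.ext (mem_filter.1 hx).2 hxa⟩
  have hsupp : (univ.filter fun x => C x ≠ 0) = T := by
    ext x
    simp [hT]
  have hclass : ∏ j, msgn (T.filter fun x => C x = j) (coord ℓ) =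
      ∏ j, msgn (colorClass C j) (coord ℓ) := by
    rw [Fin.prod_univ_succ]
    -- Colour 0 does not occur on T, so its factor is the sign of an empty sequence.
    have h0 : T.filter (fun x => C x = 0) = ∅ :=
      filter_eq_empty_iff.2 fun x hx => (hT x).1 hx
    have hj : ∀ j : Fin n, T.filter (fun x => C x = j.succ) = colorClass C j := fun j => by
      ext x
      rw [mem_filter, mem_colorClass, hT]
      exact ⟨fun h => h.2, fun h => ⟨h ▸ Fin.succ_ne_zero j, h⟩⟩
    simp only [h0, hj]
    simp [msgn, inv]
  have key := msgn_mul_fiber_eq hbij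
  rw [hclass] at key
  rw [dirSign, hsupp, ← key, mul_assoc, mul_mul_mul_comm (msgn T C) _ (msgn T C),
    msgn_mul_self, one_mul, ← prod_mul_distrib, prod_eq_one fun j _ => msgn_mul_self _ _, mul_one]
  rfl

/-- Multiplying over the directions raises `gridSign` and the colour sign to the power d; both
square to 1, so oddness of d leaves one copy of each. -/
theorem setSign_mul_fullSign (hd : Odd d) {T : Finset (Cell d k)} {C : Cell d k → Fin (n + 1)}
    (h : IsPartialLatin T C) :
    setSign T * fullSign C = gridSign k n * (msgn T C * ∏ j, setSign (colorClass C j)) := by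
  rw [setSign, fullSign, ← prod_mul_distrib, prod_congr rfl fun ℓ _ => msgn_mul_dirSign h ℓ,
    prod_mul_distrib, prod_mul_distrib, prod_const, prod_const, card_univ, Fintype.card_fin,
    pow_odd_of_mul_self (gridSign_mul_self k n) hd, pow_odd_of_mul_self (msgn_mul_self T C) hd,
    prod_comm]
  rfl

/-- Pairs (T, C) correspond to disjoint n-tuples of diagonals through the colour classes, and the
sign of each term is given by `setSign_mul_fullSign`. -/
theorem omega_pow_eq_sum [NeZero d] (hd : Odd d) (n : ℕ) :
    omega d k ^ n = (gridSign k n : ℂ) • ∑ T ∈ magicSets d k n,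
      ((setSign T * AT d k n T : ℤ) : ℂ) • psi T := by
  classical
  rw [omega_pow, ← sum_filter_of_ne
    (p := fun P : Fin n → Finset (Cell d k) => Pairwise fun i j => Disjoint (P i) (P j))]
  · have hAT : ∀ T ∈ magicSets d k n, ((setSign T * AT d k n T : ℤ) : ℂ) • psi T =
        ∑ C ∈ univ.filter (IsPartialLatin (n := n) T),
          ((setSign T * fullSign C : ℤ) : ℂ) • psi T := by
      intro T _
      rw [AT, mul_sum, Int.cast_sum, sum_smul]
    rw [sum_congr rfl hAT, sum_sigma', smul_sum]
    symm
    refine sum_bij (fun a _ => colorClass a.2) ?_ ?_ ?_ ?_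
    · rintro ⟨T, C⟩ ha
      simp only [mem_sigma, mem_filter, mem_univ, true_and] at ha
      exact mem_filter.2 ⟨Fintype.mem_piFinset.2 (isPartialLatin_iff.1 ha.2).2,
        colorClass_pairwise_disjoint C⟩
    · rintro ⟨T, C⟩ ha ⟨T', C'⟩ ha' heq
      simp only [mem_sigma, mem_filter, mem_univ, true_and] at ha ha'
      obtain rfl := colorClass_injective d k n heq
      obtain rfl : T = T' := by
        ext x
        rw [ha.2.2.1, ha'.2.2.1]
      rfl
    · intro P hP
      obtain ⟨hP1, hP2⟩ := mem_filter.1 hP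
      obtain ⟨C, rfl⟩ := exists_colorClass_eq hP2
      have hL : IsPartialLatin (univ.filter fun x => C x ≠ 0) C :=
        isPartialLatin_iff.2 ⟨by simp, Fintype.mem_piFinset.1 hP1⟩
      exact ⟨⟨_, C⟩, mem_sigma.2 ⟨hL.1, mem_filter.2 ⟨mem_univ _, hL⟩⟩, rfl⟩
    · rintro ⟨T, C⟩ ha
      simp only [mem_sigma, mem_filter, mem_univ, true_and] at ha
      rw [prod_psi_eq_msgn_smul C Fin.succ (fun _ _ h => Fin.succ_lt_succ_iff.2 h)
        fun j x hx => mem_colorClass.1 hx, biUnion_colorClass ha.2.2.1, smul_smul, smul_smul,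
        ← Int.cast_mul, ← Int.cast_mul, setSign_mul_fullSign hd ha.2, ← mul_assoc,
        gridSign_mul_self, one_mul, mul_comm]
  · intro P _ hP
    by_contra h
    exact hP (by rw [prod_psi_eq_zero h, smul_zero])

end PartialLatin

/-! ### The full box and the final assembly -/

theorem card_cell (d k : ℕ) : Fintype.card (Cell d k) = k ^ d := by
  simp [Cell, Lex]

theorem magicSets_full {d k : ℕ} [NeZero d] : magicSets d k (k ^ (d - 1)) = {univ} := by
  have hpow : k ^ (d - 1) * k = k ^ d := by
    rw [← pow_succ, Nat.sub_add_cancel (NeZero.pos d)]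
  ext T
  rw [mem_singleton]
  constructor
  · intro hT
    rw [← card_eq_iff_eq_univ, card_cell, ← hpow]
    simp only [magicSets, mem_filter] at hT
    exact hT.2.2
  · rintro rfl
    rw [mem_magicSets]
    -- Changing the ℓ-th coordinate from i to i' is a bijection between the two slices of the box.
    have hconst : ∀ ℓ (i i' : Fin k), (sliceOf (univ : Finset (Cell d k)) ℓ i).card =
        (sliceOf univ ℓ i').card := by
      intro ℓ i i'
      have hs : ∀ (a b : Fin k) (x : Cell d k), x ∈ sliceOf univ ℓ a →
          updCell x ℓ b ∈ sliceOf univ ℓ b := fun a b x _ => by simp [sliceOf, coord_updCell]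
      refine card_bij' (fun x _ => updCell x ℓ i') (fun x _ => updCell x ℓ i) (hs _ _) (hs _ _)
        ?_ ?_ <;>
      · intro x hx
        rw [updCell_updCell]
        refine cell_ext fun ℓ' => ?_
        rw [coord_updCell]
        split_ifs with h
        · rw [h, (mem_filter.1 hx).2]
        · rfl
    intro ℓ i
    have h := sum_card_sliceOf (univ : Finset (Cell d k)) ℓ
    rw [sum_congr rfl fun j _ => hconst ℓ j i, sum_const, card_univ, card_univ, Fintype.card_fin,
      card_cell, ← hpow, smul_eq_mul, mul_comm] at h
    exact Nat.eq_of_mul_eq_mul_right i.pos h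

theorem cast_eq_one_or_eq_neg_one {a : ℤ} (h : a * a = 1) : (a : ℂ) = 1 ∨ (a : ℂ) = -1 := by
  rcases mul_self_eq_one_iff.1 h with rfl | rfl <;> simp

theorem omega_mem_exteriorPower (d k : ℕ) : omega d k ∈ ⋀[ℂ]^k (TensorSpace d k) :=
  Submodule.sum_mem _ fun _ _ =>
    Submodule.smul_mem _ _ (ExteriorAlgebra.ιMulti_range ℂ k (Set.mem_range_self _))

end HyperForm

end

theorem theorem8p3 (d k : ℕ) (hd : 3 ≤ d) (hodd : Odd d) :
    -- (i) up to nonzero scalars, `ω` is the only highest weight vector in `B_{d,k}(1)`, and the only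
    -- one of weight `(k × 1)^d` in `⋀^k (ℂ^k)^{⊗ d}`
    (∀ v : HyperForm.Forms d k,
      (v ∈ HyperForm.weightB d k 1 ∧ HyperForm.IsHighestWeightVector v) ↔
        ∃ c : ℂ, c ≠ 0 ∧ v = c • HyperForm.omega d k) ∧
    (∀ v : HyperForm.Forms d k,
      (v ∈ ⋀[ℂ]^k (HyperForm.TensorSpace d k) ∧ HyperForm.IsHighestWeightVector v ∧
          HyperForm.HasWeight (fun _ _ => 1) v) ↔
        ∃ c : ℂ, c ≠ 0 ∧ v = c • HyperForm.omega d k) ∧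
    -- (ii) the powers of `ω` for even `k`
    (Even k →
      (∀ n : ℕ, n ≤ k ^ (d - 1) → ∃ s : ℂ, (s = 1 ∨ s = -1) ∧
        HyperForm.omega d k ^ n =
          s • ∑ T ∈ HyperForm.magicSets d k n,
            ((HyperForm.setSign T * HyperForm.AT d k n T : ℤ) : ℂ) • HyperForm.psi T) ∧
      ∃ s : ℂ, (s = 1 ∨ s = -1) ∧
        HyperForm.omega d k ^ (k ^ (d - 1)) =
          s • ((HyperForm.ATfull d k : ℤ) : ℂ) •
            HyperForm.psi (Finset.univ : Finset (HyperForm.Cell d k))) ∧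
    -- (iii) odd `k`
    (Odd k → HyperForm.omega d k ^ 2 = 0) := by

  have : NeZero d := ⟨by omega⟩
  have huniq : ∀ v, v ∈ HyperForm.weightB d k 1 → HyperForm.IsHighestWeightVector v →
      ∃ c : ℂ, c ≠ 0 ∧ v = c • HyperForm.omega d k := by
    intro v hv hw
    obtain ⟨c, hc⟩ := HyperForm.exists_eq_smul_omega hodd hv hw.2.2
    refine ⟨c, ?_, hc⟩
    rintro rfl
    exact hw.1 (by rw [hc, zero_smul])
  refine ⟨fun v => ⟨fun h => huniq v h.1 h.2, ?_⟩,
    fun v => ⟨fun h => huniq v (HyperForm.mem_weightB_of_hasWeight h.2.2) h.2.1, ?_⟩,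
    fun _ => ⟨fun n _ => ?_, ?_⟩, HyperForm.omega_sq_eq_zero d⟩
  · rintro ⟨c, hc, rfl⟩
    exact ⟨Submodule.smul_mem _ _ HyperForm.omega_mem_weightB,
      (HyperForm.isHighestWeightVector_smul_omega hodd hc).1⟩
  · rintro ⟨c, hc, rfl⟩
    exact ⟨Submodule.smul_mem _ _ (HyperForm.omega_mem_exteriorPower d k),
      HyperForm.isHighestWeightVector_smul_omega hodd hc⟩
  · exact ⟨_, HyperForm.cast_eq_one_or_eq_neg_one (HyperForm.gridSign_mul_self k n),
      HyperForm.omega_pow_eq_sum hodd n⟩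
  · refine ⟨((HyperForm.gridSign k (k ^ (d - 1)) *
        HyperForm.setSign (Finset.univ : Finset (HyperForm.Cell d k)) : ℤ) : ℂ),
      HyperForm.cast_eq_one_or_eq_neg_one ?_, ?_⟩
    · rw [mul_mul_mul_comm, HyperForm.gridSign_mul_self, HyperForm.setSign_mul_self, one_mul]
    · rw [HyperForm.omega_pow_eq_sum hodd, HyperForm.magicSets_full, Finset.sum_singleton,
        HyperForm.ATfull, smul_smul, smul_smul, ← Int.cast_mul, ← Int.cast_mul, mul_assoc]
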